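/- Let $n,m\ge 0$ be integers, let $D\subset\mathbb{R}^n$ be open, let $f:D\to\mathbb{R}^m$ be smooth, and let $\Sigma\subset\mathbb{R}^{n+m}$ be the graph of $f$. Put $c=1$ if $m\le 2$ or $n\le 2$, and $c=\min(m-1,n-1)$ otherwise, and let $$*\Omega=\frac{1}{\sqrt{\det\left(I+(df)^{T}df\right)}},$$ which is the Jacobian of the projection $\Sigma\to D$. Call $\Sigma$ minimal if its mean curvature vector vanishes identically. Call $\Sigma$ stable if, for every smooth one-parameter family of maps $F_s:D\to\mathbb{R}^{n+m}$, $|s|<\varepsilon$, with $F_0(x)=(x,f(x))$, with $F_s=F_0$ outside a compact set $K\subset D$, and with variation field $\partial_sF_s|_{s=0}$ normal to $\Sigma$, the volume $\int_K\sqrt{\det(\langle\partial_iF_s,\partial_jF_s\rangle)}\,dx$ is twice differentiable in $s$ at $s=0$ with nonnegative second derivative there. If $\Sigma$ is minimal and $$*\Omega\ \ge\ \frac{c}{2\left(c+1-\sqrt{1+c}\right)}\quad\text{at every point of }D,$$ then $\Sigma$ is stable. In particular, if $m\le 2$ or $n\le 2$, and $\Sigma$ is minimal with $*\Omega\ge\frac{2+\sqrt2}{4}$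 at every point of $D$, then $\Sigma$ is stable. -/

import Mathlib

namespace MinimalGraph

open Set Filter Topology MeasureTheory
open scoped ContDiff

noncomputable section

/-- Euclidean space of dimension `n`. -/
abbrev E (n : ℕ) : Type := EuclideanSpace ℝ (Fin n)

/-- The ambient Euclidean space of dimension `n + m`; the first `n` coordinates are those of the
domain factor and the last `m` coordinates those of the target factor. -/
abbrev Ambient (n m : ℕ) : Type := EuclideanSpace ℝ (Fin n ⊕ Fin m)

/-- The coordinate derivative `∂F / ∂xⁱ`. -/
def partialD {n : ℕ} {W : Type*} [NormedAddCommGroup W] [NormedSpace ℝ W]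
    (F : E n → W) (i : Fin n) (x : E n) : W :=
  fderiv ℝ F x (EuclideanSpace.single i 1)

/-- The induced metric `g_ij = ⟨∂F/∂xⁱ, ∂F/∂xʲ⟩` of a parametrized submanifold. -/
def metric {n m : ℕ} (F : E n → Ambient n m) (x : E n) : Matrix (Fin n) (Fin n) ℝ :=
  Matrix.of fun i j => inner ℝ (partialD F i x) (partialD F j x)

/-- `ν` is normal to the parametrized submanifold `F` at the parameter `x`. -/
def IsNormalAt {n m : ℕ} (F : E n → Ambient n m) (x : E n) (ν : Ambient n m) : Prop :=
  ∀ i : Fin n, inner ℝ ν (partialD F i x) = 0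

/-- The parametrized submanifold `F` is minimal over `D`: its mean curvature vector, the normal
part of `∑ g^ij ∂²F/∂xⁱ∂xʲ`, vanishes at every point of `D`. -/
def IsMinimalOn {n m : ℕ} (F : E n → Ambient n m) (D : Set (E n)) : Prop :=
  ∀ x ∈ D, ∀ ν : Ambient n m, IsNormalAt F x ν →
    ∑ i, ∑ j, (metric F x)⁻¹ i j * inner ℝ (partialD (partialD F j) i x) ν = 0

/-- The volume of the part of the parametrized submanifold `F` lying over `K`. -/
def volumeOver {n m : ℕ} (K : Set (E n)) (F : E n → Ambient n m) : ℝ :=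
  ∫ x in K, Real.sqrt (metric F x).det

/-- `F s`, for `|s| < ε`, is a smooth variation over `D` of the submanifold `F₀` which is
supported in `K` and whose variation field `∂F/∂s` at `s = 0` is normal. (If `F₀` is an immersion
and `K ⊆ D` is compact, then `F s` is an immersion of `D` for all small `s`.) -/
structure IsNormalVariation {n m : ℕ} (D K : Set (E n)) (F₀ : E n → Ambient n m)
    (ε : ℝ) (F : ℝ → E n → Ambient n m) : Prop where
  smooth : ContDiffOn ℝ ∞ (fun p : ℝ × E n => F p.1 p.2) (Ioo (-ε) ε ×ˢ D)
  initial : ∀ x ∈ D, F 0 x = F₀ x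
  support : ∀ s ∈ Ioo (-ε) ε, ∀ x ∈ D \ K, F s x = F₀ x
  normal : ∀ x ∈ D, IsNormalAt F₀ x (deriv (fun s => F s x) 0)

/-- The parametrized submanifold `F₀` over `D` is stable: for every compactly supported variation
with normal variation field, the volume is twice differentiable at `s = 0` and its second
derivative there is nonnegative. Since only the part over the compact set `K` is moved, only the
volume of that part is taken (the total volume may be infinite). -/
def IsStableOn {n m : ℕ} (F₀ : E n → Ambient n m) (D : Set (E n)) : Prop :=
  ∀ K : Set (E n), IsCompact K → K ⊆ D →
  ∀ (ε : ℝ) (F : ℝ → E n → Ambient n m), 0 < ε → IsNormalVariation D K F₀ ε F →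
    (∀ᶠ s in 𝓝 (0 : ℝ), DifferentiableAt ℝ (fun t => volumeOver K (F t)) s) ∧
    DifferentiableAt ℝ (deriv fun t => volumeOver K (F t)) 0 ∧
    0 ≤ deriv (deriv fun t => volumeOver K (F t)) 0

/-- The graph `x ↦ (x, f x)` of `f`, parametrized over its domain. -/
def graphMap {n m : ℕ} (f : E n → E m) (x : E n) : Ambient n m :=
  WithLp.toLp 2 (Sum.elim (fun i => x i) (fun a => f x a))

/-- The matrix of the differential `df` at `x`. -/
def jacobian {n m : ℕ} (f : E n → E m) (x : E n) : Matrix (Fin m) (Fin n) ℝ :=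
  Matrix.of fun a i => partialD f i x a

/-- The function `*Ω = 1 / √det(I + (df)ᵀ df)` of the graph of `f`, i.e. the Jacobian of the
projection of the graph to the domain. -/
def starOmega {n m : ℕ} (f : E n → E m) (x : E n) : ℝ :=
  1 / Real.sqrt (1 + (jacobian f x).transpose * jacobian f x).det

/-- The constant `c`: it is `1` if `m ≤ 2` or `n ≤ 2`, and `min (m - 1) (n - 1)` otherwise. -/
def stabilityConst (n m : ℕ) : ℝ :=
  if m ≤ 2 ∨ n ≤ 2 then 1 else min ((m : ℝ) - 1) ((n : ℝ) - 1)

end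

end MinimalGraph

namespace MinimalGraph

open Set Filter Topology MeasureTheory
open scoped ContDiff

/-! ### The quadratic form of the area integrand -/

/-! The thresholds enter only through `*Ω ≥ 1/2`, that is `det (I + dfᵀ df) ≤ 4`, which already
forces stability of a minimal graph.

Regard the area integrand as a function `a(M) = √det(MᵀM)` of the differential `M = dF`. For a
minimal immersion the first variation `∫ Da(dF)(dw)` vanishes for every compactly supported `w`
(`firstVariation_eq_zero`). Hence the acceleration of a family drops out, and the second derivative
of volume is `∫ D²a(dF)(dV, dV)` with `V` the variation field. The behaviour of `a` under
reparametrization shows that `D²a(dF)(dY, d(dF·X))` is a divergence minus a first variation, so a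
compactly supported tangential field `dF·X` pairs to zero with every `Y`
(`secondVariation_tangential_eq_zero`). On a graph, `V = U + dF·X` with `X` the horizontal part of
`V` and `U` vertical, so only `∫ D²a(dF)(dU, dU)` remains.

For vertical `U` this integrand is pointwise nonnegative (`densityHessian_nonneg`): it is the
Hessian of `J ↦ √det(I + JᵀJ)`. In terms of the singular values `l i` of `df`, and up to the
positive factor `a`, it is bounded below by `∑ (y i j² − l i l j y i j y j i) / ((1 + l i²)(1 + l
j²)) + (∑ l i y i i / (1 + l i²))²`. The off-diagonal part needs `l i l j ≤ 1`. The diagonal part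
has at most one negative coefficient, compensated by the squared sum. Both follow from `∏ (1 + l i²)
≤ 4`. -/

theorem sum_div_one_sub_le {ι : Type*} [DecidableEq ι] (s : Finset ι) (b : ι → ℝ)
    (hb : ∀ i ∈ s, 0 ≤ b i) (hP : ∏ i ∈ s, (1 + b i) < 2) :
    ∑ i ∈ s, b i / (1 - b i) ≤ (∏ i ∈ s, (1 + b i) - 1) / (2 - ∏ i ∈ s, (1 + b i)) := by
  induction s using Finset.induction_on with
  | empty => simp
  | insert k s hk ih =>
    rw [Finset.prod_insert hk] at hP ⊢
    rw [Finset.sum_insert hk]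
    have hbk : 0 ≤ b k := hb k (Finset.mem_insert_self k s)
    have hbs : ∀ i ∈ s, 0 ≤ b i := fun i hi => hb i (Finset.mem_insert_of_mem hi)
    have h1 : 1 ≤ ∏ i ∈ s, (1 + b i) := by
      simpa using Finset.prod_le_prod (f := fun _ => (1 : ℝ)) (g := fun i => 1 + b i)
        (fun _ _ => zero_le_one) fun i hi => by linarith [hbs i hi]
    set P := ∏ i ∈ s, (1 + b i)
    have hPlt : P < 2 := by nlinarith
    have hblt : b k < 1 := by nlinarith
    refine (add_le_add le_rfl (ih hbs hPlt)).trans ?_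
    have e1 : 0 < 1 - b k := by linarith
    have e2 : 0 < 2 - P := by linarith
    have e3 : 0 < 2 - (1 + b k) * P := by linarith
    rw [div_add_div _ _ e1.ne' e2.ne', div_le_div_iff₀ (mul_pos e1 e2) e3]
    -- With `a = b k` and `d = P - 1`, clearing denominators in `a/(1-a) + d/(1-d) ≤
    -- (a+d+ad)/(1-a-d-ad)` leaves exactly `a d (3 - a - d - a d) ≥ 0`.
    have : 0 ≤ b k * (P - 1) * (3 - b k - (P - 1) - b k * (P - 1)) :=
      mul_nonneg (mul_nonneg hbk (by linarith)) (by nlinarith)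
    nlinarith [this]

/-- The omitted factors are at least 1. Since `(1 + |l i l j|)² ≤ (1 + l i²)(1 + l j²)`, this yields
`|l i l j| ≤ 1` for distinct indices. -/
theorem mul_le_one_of_prod_le {ι : Type*} [Fintype ι] [DecidableEq ι] (l : ι → ℝ)
    (hP : ∏ i, (1 + l i ^ 2) ≤ 4) {i j : ι} (hij : i ≠ j) :
    (1 + l i ^ 2) * (1 + l j ^ 2) ≤ 4 := by
  refine le_trans ?_ hP
  rw [← Finset.prod_pair (f := fun k => 1 + l k ^ 2) hij]
  rw [← Finset.prod_sdiff (Finset.subset_univ {i, j})]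
  refine le_mul_of_one_le_left (Finset.prod_nonneg fun k _ => by positivity) ?_
  simpa using Finset.prod_le_prod (s := Finset.univ \ {i, j}) (f := fun _ => (1 : ℝ))
    (g := fun k => 1 + l k ^ 2) (fun _ _ => zero_le_one) fun k _ => by nlinarith [sq_nonneg (l k)]

/-- At most one `l k²` exceeds 1. Completing the square in `z k` turns the form into `(z k + l k S)²
+ R - (l k² - 1) S²`, with `S = ∑ l i z i` and `R = ∑ (1 - l i²) z i²` over the other indices.
Weighted Cauchy–Schwarz, `S² ≤ Q R`, reduces the claim to `(l k² - 1) Q ≤ 1`. -/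
theorem diagonal_form_nonneg {ι : Type*} [Fintype ι] [DecidableEq ι] (l z : ι → ℝ)
    (hP : ∏ i, (1 + l i ^ 2) ≤ 4) :
    0 ≤ ∑ i, (1 - l i ^ 2) * z i ^ 2 + (∑ i, l i * z i) ^ 2 := by
  by_cases hall : ∀ i, l i ^ 2 ≤ 1
  · exact add_nonneg (Finset.sum_nonneg fun i _ =>
      mul_nonneg (by linarith [hall i]) (sq_nonneg _)) (sq_nonneg _)
  push Not at hall
  obtain ⟨k, hk⟩ := hall
  set s : Finset ι := Finset.univ.erase k
  have hlt : ∀ i ∈ s, l i ^ 2 < 1 := fun i hi => by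
    have := mul_le_one_of_prod_le l hP (Finset.ne_of_mem_erase hi)
    nlinarith [sq_nonneg (l i)]
  have hprod : (1 + l k ^ 2) * ∏ i ∈ s, (1 + l i ^ 2) ≤ 4 := by
    rwa [Finset.mul_prod_erase _ (fun i => 1 + l i ^ 2) (Finset.mem_univ k)]
  rw [← Finset.add_sum_erase _ _ (Finset.mem_univ k),
    ← Finset.add_sum_erase _ (fun i => l i * z i) (Finset.mem_univ k)]
  have hP2 : ∏ i ∈ s, (1 + l i ^ 2) < 2 := by nlinarith
  have hsum := sum_div_one_sub_le s (fun i => l i ^ 2) (fun i _ => sq_nonneg _) hP2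
  set P := ∏ i ∈ s, (1 + l i ^ 2)
  -- After the bound on the sum, the claim is `l k² P ≤ 1 + l k²`. As `P ≤ 4 / (1 + l k²)`, it
  -- follows from `4 l k² ≤ (1 + l k²)²`; this is where the constant 4 is used.
  have hbound : (l k ^ 2 - 1) * ∑ i ∈ s, l i ^ 2 / (1 - l i ^ 2) ≤ 1 := by
    refine (mul_le_mul_of_nonneg_left hsum (by linarith)).trans ?_
    rw [← mul_div_assoc, div_le_one (by linarith)]
    nlinarith [sq_nonneg (l k ^ 2 - 1)]
  have hcs : (∑ i ∈ s, l i * z i) ^ 2 ≤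
      (∑ i ∈ s, l i ^ 2 / (1 - l i ^ 2)) * ∑ i ∈ s, (1 - l i ^ 2) * z i ^ 2 := by
    refine Finset.sum_sq_le_sum_mul_sum_of_sq_le_mul s
      (fun i hi => div_nonneg (sq_nonneg _) (by linarith [hlt i hi]))
      (fun i hi => mul_nonneg (by linarith [hlt i hi]) (sq_nonneg _)) fun i hi => ?_
    have : 1 - l i ^ 2 ≠ 0 := by linarith [hlt i hi]
    exact le_of_eq (by field_simp)
  have hR : 0 ≤ ∑ i ∈ s, (1 - l i ^ 2) * z i ^ 2 := Finset.sum_nonneg fun i hi =>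
    mul_nonneg (by linarith [hlt i hi]) (sq_nonneg _)
  set S := ∑ i ∈ s, l i * z i
  set R := ∑ i ∈ s, (1 - l i ^ 2) * z i ^ 2
  set Q := ∑ i ∈ s, l i ^ 2 / (1 - l i ^ 2)
  have h1 : (l k ^ 2 - 1) * S ^ 2 ≤ R := by
    calc (l k ^ 2 - 1) * S ^ 2 ≤ (l k ^ 2 - 1) * (Q * R) :=
          mul_le_mul_of_nonneg_left hcs (by linarith)
      _ = ((l k ^ 2 - 1) * Q) * R := by ring
      _ ≤ 1 * R := mul_le_mul_of_nonneg_right hbound hR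
      _ = R := one_mul R
  nlinarith [sq_nonneg (z k + l k * S)]

theorem offDiagonal_form_nonneg {ι : Type*} [Fintype ι] [DecidableEq ι] (l : ι → ℝ)
    (y : ι → ι → ℝ) (hP : ∏ i, (1 + l i ^ 2) ≤ 4) :
    0 ≤ ∑ i, ∑ j, (y i j ^ 2 - l i * l j * y i j * y j i) /
        ((1 + l i ^ 2) * (1 + l j ^ 2)) + (∑ i, l i * y i i / (1 + l i ^ 2)) ^ 2 := by
  set c : ι → ι → ℝ := fun i j => ((1 + l i ^ 2) * (1 + l j ^ 2))⁻¹ with hc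
  have hc0 : ∀ i j, 0 ≤ c i j := fun i j => by positivity
  have hdiag := diagonal_form_nonneg l (fun i => y i i / (1 + l i ^ 2)) hP
  -- Nonnegativity holds only for the pair `(i, j)`, `(j, i)` taken together. Comparing with the
  -- antisymmetric `(y i j² - y j i²)/2` gives a bound for each ordered pair; since the weight `c`
  -- is symmetric, this correction sums to zero.
  have hsplit : ∀ i j, (if i = j then (1 - l i ^ 2) * (y i i / (1 + l i ^ 2)) ^ 2 else 0) +
      ((y i j ^ 2 - y j i ^ 2) / 2) * c i j ≤
      (y i j ^ 2 - l i * l j * y i j * y j i) / ((1 + l i ^ 2) * (1 + l j ^ 2)) := by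
    intro i j
    rw [div_eq_mul_inv (y i j ^ 2 - _)]
    by_cases hij : i = j
    · subst hij
      have h0 : (1 + l i ^ 2) ≠ 0 := by positivity
      simp only [if_true, hc]
      apply le_of_eq
      field_simp
      ring
    · rw [if_neg hij, zero_add]
      refine mul_le_mul_of_nonneg_right ?_ (hc0 i j)
      have h4 := mul_le_one_of_prod_le l hP hij
      have hle : (l i * l j) ^ 2 ≤ 1 := by
        nlinarith [sq_nonneg (l i - l j), sq_nonneg (l i + l j), sq_nonneg (l i * l j),
          sq_nonneg (l i * l j - 1), sq_nonneg (l i * l j + 1)]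
      have habs := abs_le.1 ((sq_le_one_iff_abs_le_one _).1 hle)
      nlinarith [mul_nonneg (by linarith [habs.2] : 0 ≤ 1 - l i * l j)
          (sq_nonneg (y i j + y j i)),
        mul_nonneg (by linarith [habs.1] : 0 ≤ 1 + l i * l j) (sq_nonneg (y i j - y j i))]
  have hanti : ∑ i, ∑ j, ((y i j ^ 2 - y j i ^ 2) / 2) * c i j = 0 := by
    have : ∑ i, ∑ j, ((y i j ^ 2 - y j i ^ 2) / 2) * c i j =
        ∑ i, ∑ j, -(((y i j ^ 2 - y j i ^ 2) / 2) * c i j) := by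
      rw [Finset.sum_comm]
      refine Finset.sum_congr rfl fun i _ => Finset.sum_congr rfl fun j _ => ?_
      simp only [hc, mul_comm (1 + l j ^ 2)]
      ring
    simp only [Finset.sum_neg_distrib] at this
    linarith
  have hsum := Finset.sum_le_sum fun i (_ : i ∈ Finset.univ) =>
    Finset.sum_le_sum fun j (_ : j ∈ Finset.univ) => hsplit i j
  simp only [Finset.sum_add_distrib, hanti, add_zero, Finset.sum_ite_eq, Finset.mem_univ,
    if_true] at hsum
  simp only [← mul_div_assoc (l _)] at hdiag
  linarith

/-- With `G` the metric, `C` its mixed first variation and `N` the metric of the variation, this is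
the second variation of `√det G` divided by `√det G`. -/
noncomputable def densityHessian {ι : Type*} [Fintype ι] [DecidableEq ι] (G C N : Matrix ι ι ℝ) : ℝ :=
  (G⁻¹ * C).trace ^ 2 + (G⁻¹ * N).trace - (G⁻¹ * (C + C.transpose) * G⁻¹ * C).trace

open Matrix in
theorem densityHessian_conj {ι : Type*} [Fintype ι] [DecidableEq ι] (U G C N : Matrix ι ι ℝ)
    (hU : Uᵀ * U = 1) (hG : IsUnit G.det) :
    densityHessian (U * G * Uᵀ) (U * C * Uᵀ) (U * N * Uᵀ) = densityHessian G C N := by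
  have hU' : U * Uᵀ = 1 := mul_eq_one_comm.1 hU
  have hinv : (U * G * Uᵀ)⁻¹ = U * G⁻¹ * Uᵀ := by
    refine inv_eq_right_inv ?_
    calc U * G * Uᵀ * (U * G⁻¹ * Uᵀ) = U * G * (Uᵀ * U) * G⁻¹ * Uᵀ := by
          simp only [Matrix.mul_assoc]
      _ = U * (G * G⁻¹) * Uᵀ := by rw [hU]; simp only [Matrix.mul_assoc, Matrix.one_mul]
      _ = 1 := by rw [mul_nonsing_inv _ hG, Matrix.mul_one, hU']
  have hmul : ∀ X Y : Matrix ι ι ℝ, U * X * Uᵀ * (U * Y * Uᵀ) = U * (X * Y) * Uᵀ := by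
    intro X Y
    calc U * X * Uᵀ * (U * Y * Uᵀ) = U * X * (Uᵀ * U) * Y * Uᵀ := by
          simp only [Matrix.mul_assoc]
      _ = _ := by rw [hU]; simp only [Matrix.mul_assoc, Matrix.one_mul]
  have htr : ∀ X : Matrix ι ι ℝ, (U * X * Uᵀ).trace = X.trace := by
    intro X
    rw [trace_mul_cycle, hU, Matrix.one_mul]
  have hadd : U * C * Uᵀ + (U * C * Uᵀ)ᵀ = U * (C + Cᵀ) * Uᵀ := by
    simp only [transpose_mul, transpose_transpose, Matrix.mul_add, Matrix.add_mul,
      Matrix.mul_assoc]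
  simp only [densityHessian, hinv, hadd, hmul, htr]

open Matrix in
-- The columns of `J` are orthogonal, so `y i j` is the component of column `i` of `B` along the
-- normalized column `j` of `J`. Bessel's inequality discards the part of `B` orthogonal to the
-- image of `J`, leaving the form of `offDiagonal_form_nonneg`.
theorem densityHessian_nonneg_of_diagonal {ι κ : Type*} [Fintype ι] [DecidableEq ι] [Fintype κ]
    (J B : Matrix κ ι ℝ) (μ : ι → ℝ) (hJ : Jᵀ * J = diagonal μ) (hP : ∏ i, (1 + μ i) ≤ 4) :
    0 ≤ densityHessian (1 + Jᵀ * J) (Jᵀ * B) (Bᵀ * B) := by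
  have hμ : ∀ i, μ i = ∑ a, J a i ^ 2 := fun i => by
    have := congrFun (congrFun hJ i) i
    simp only [mul_apply, transpose_apply, diagonal_apply_eq] at this
    rw [← this]
    exact Finset.sum_congr rfl fun a _ => by ring
  have hμ0 : ∀ i, 0 ≤ μ i := fun i => hμ i ▸ Finset.sum_nonneg fun a _ => sq_nonneg _
  have hpos : ∀ i, 0 < 1 + μ i := fun i => by linarith [hμ0 i]
  set l : ι → ℝ := fun i => Real.sqrt (μ i)
  have hl : ∀ i, l i ^ 2 = μ i := fun i => Real.sq_sqrt (hμ0 i)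
  set C := Jᵀ * B with hC
  -- When `μ j = 0` the division gives `w i j = 0`, which is harmless because column `j` of `J` then
  -- vanishes.
  set w : ι → ι → ℝ := fun i j => C j i / μ j with hw
  set y : ι → ι → ℝ := fun i j => l j * w i j with hy
  have hCw : ∀ i j, C j i = μ j * w i j := by
    intro i j
    by_cases h0 : μ j = 0
    · have hcol : ∀ a, J a j = 0 := by
        intro a
        have := (Finset.sum_eq_zero_iff_of_nonneg fun a _ => sq_nonneg (J a j)).1
          ((hμ j).symm.trans h0) a (Finset.mem_univ a)
        simpa using this
      simp [hC, mul_apply, hcol, h0]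
    · simp only [hw]
      field_simp
  have hCy : ∀ i j, C j i = l j * y i j := by
    intro i j
    rw [hCw, ← hl]
    simp only [hy]
    ring
  have hbessel : ∀ i, ∑ j, y i j ^ 2 ≤ (Bᵀ * B) i i := by
    intro i
    have h0 : 0 ≤ (B.col i - J *ᵥ w i) ⬝ᵥ (B.col i - J *ᵥ w i) :=
      Finset.sum_nonneg fun a _ => mul_self_nonneg _
    have e1 : B.col i ⬝ᵥ B.col i = (Bᵀ * B) i i := by
      simp [dotProduct, mul_apply]
    have e2 : (J *ᵥ w i) ⬝ᵥ B.col i = ∑ j, y i j ^ 2 := by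
      rw [dotProduct_comm, dotProduct_mulVec, ← mulVec_transpose]
      refine Finset.sum_congr rfl fun j _ => ?_
      have : (Jᵀ *ᵥ B.col i) j = C j i := by simp [hC, mulVec, dotProduct, mul_apply]
      rw [this, hCw, ← hl]
      simp only [hy]
      ring
    have e3 : (J *ᵥ w i) ⬝ᵥ (J *ᵥ w i) = ∑ j, y i j ^ 2 := by
      rw [dotProduct_mulVec, ← mulVec_transpose, mulVec_mulVec, hJ]
      refine Finset.sum_congr rfl fun j _ => ?_
      rw [mulVec_diagonal, ← hl]
      simp only [hy]
      ring
    rw [sub_dotProduct, dotProduct_sub, dotProduct_sub, dotProduct_comm (B.col i) (J *ᵥ w i),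
      e1, e2, e3] at h0
    linarith
  have hinv : (1 + Jᵀ * J)⁻¹ = diagonal fun i => (1 + μ i)⁻¹ := by
    refine inv_eq_right_inv ?_
    rw [hJ, ← diagonal_one, diagonal_add, diagonal_mul_diagonal, diagonal_eq_diagonal_iff]
    exact fun i => mul_inv_cancel₀ (hpos i).ne'
  have t1 : ((1 + Jᵀ * J)⁻¹ * C).trace = ∑ i, l i * y i i / (1 + l i ^ 2) := by
    rw [hinv]
    refine Finset.sum_congr rfl fun i _ => ?_
    rw [diag_apply, diagonal_mul, hCy, hl]
    ring
  have t2 : ∑ i, ∑ j, y i j ^ 2 / (1 + l i ^ 2) ≤ ((1 + Jᵀ * J)⁻¹ * (Bᵀ * B)).trace := by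
    rw [hinv]
    refine Finset.sum_le_sum fun i _ => ?_
    rw [diag_apply, diagonal_mul, ← Finset.sum_div, hl, div_eq_inv_mul]
    exact mul_le_mul_of_nonneg_left (hbessel i) (inv_nonneg.2 (hpos i).le)
  have t3 : ((1 + Jᵀ * J)⁻¹ * (C + Cᵀ) * (1 + Jᵀ * J)⁻¹ * C).trace =
      ∑ i, ∑ j, (l i * y j i + l j * y i j) * (l j * y i j) /
        ((1 + l i ^ 2) * (1 + l j ^ 2)) := by
    rw [hinv]
    refine Finset.sum_congr rfl fun i _ => ?_
    rw [diag_apply, mul_apply]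
    refine Finset.sum_congr rfl fun j _ => ?_
    rw [mul_diagonal, diagonal_mul, Matrix.add_apply, transpose_apply, hCy, hCy, hl, hl]
    have h1 := (hpos i).ne'
    have h2 := (hpos j).ne'
    field_simp
  have key := offDiagonal_form_nonneg l y (by simpa only [hl] using hP)
  have e : ∑ i, ∑ j, (y i j ^ 2 - l i * l j * y i j * y j i) /
        ((1 + l i ^ 2) * (1 + l j ^ 2)) = ∑ i, ∑ j, y i j ^ 2 / (1 + l i ^ 2) -
      ∑ i, ∑ j, (l i * y j i + l j * y i j) * (l j * y i j) /
        ((1 + l i ^ 2) * (1 + l j ^ 2)) := by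
    simp only [← Finset.sum_sub_distrib]
    refine Finset.sum_congr rfl fun i _ => Finset.sum_congr rfl fun j _ => ?_
    have h1 : 1 + l i ^ 2 ≠ 0 := by positivity
    have h2 : 1 + l j ^ 2 ≠ 0 := by positivity
    field_simp
    ring
  rw [densityHessian, t1, t3]
  linarith

open Matrix in
theorem posDef_one_add_transpose_mul {ι κ : Type*} [Fintype ι] [DecidableEq ι] [Fintype κ]
    (J : Matrix κ ι ℝ) : (1 + Jᵀ * J).PosDef := by
  have h := posSemidef_conjTranspose_mul_self J
  rw [conjTranspose_eq_transpose_of_trivial] at h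
  exact PosDef.one.add_posSemidef h

open Matrix in
-- An orthonormal eigenbasis `U` of `JᵀJ` reduces to orthogonal columns: replacing `J`, `B` by `J
-- U`, `B U` conjugates all three arguments by `U`, and neither the Hessian nor the determinant
-- changes.
theorem densityHessian_nonneg {ι κ : Type*} [Fintype ι] [DecidableEq ι] [Fintype κ]
    (J B : Matrix κ ι ℝ) (hdet : (1 + Jᵀ * J).det ≤ 4) :
    0 ≤ densityHessian (1 + Jᵀ * J) (Jᵀ * B) (Bᵀ * B) := by
  have hH : (Jᵀ * J).IsHermitian := by
    simpa only [conjTranspose_eq_transpose_of_trivial] using isHermitian_conjTranspose_mul_self J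
  set U : Matrix ι ι ℝ := (hH.eigenvectorUnitary : Matrix ι ι ℝ)
  have hU : Uᵀ * U = 1 := by
    have := Unitary.coe_star_mul_self hH.eigenvectorUnitary
    rwa [star_eq_conjTranspose, conjTranspose_eq_transpose_of_trivial] at this
  have hU' : U * Uᵀ = 1 := mul_eq_one_comm.1 hU
  obtain ⟨μ, hspec⟩ : ∃ μ : ι → ℝ, Jᵀ * J = U * diagonal μ * Uᵀ := by
    refine ⟨hH.eigenvalues, ?_⟩
    have := hH.spectral_theorem
    rw [Unitary.conjStarAlgAut_apply, star_eq_conjTranspose,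
      conjTranspose_eq_transpose_of_trivial] at this
    exact this
  have hJ' : (J * U)ᵀ * (J * U) = diagonal μ := by
    calc (J * U)ᵀ * (J * U) = Uᵀ * (Jᵀ * J) * U := by
          simp only [transpose_mul, Matrix.mul_assoc]
      _ = (Uᵀ * U) * diagonal μ * (Uᵀ * U) := by
          rw [hspec]; simp only [Matrix.mul_assoc]
      _ = _ := by rw [hU, Matrix.one_mul, Matrix.mul_one]
  have hback : ∀ X Y : Matrix κ ι ℝ, U * ((X * U)ᵀ * (Y * U)) * Uᵀ = Xᵀ * Y := by
    intro X Y
    calc U * ((X * U)ᵀ * (Y * U)) * Uᵀ = (U * Uᵀ) * (Xᵀ * Y) * (U * Uᵀ) := by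
          simp only [transpose_mul, Matrix.mul_assoc]
      _ = _ := by rw [hU', Matrix.one_mul, Matrix.mul_one]
  have hG : U * (1 + (J * U)ᵀ * (J * U)) * Uᵀ = 1 + Jᵀ * J := by
    rw [Matrix.mul_add, Matrix.add_mul, hback, Matrix.mul_one, hU']
  have hdet' : (1 + (J * U)ᵀ * (J * U)).det = ∏ i, (1 + μ i) := by
    rw [hJ', ← diagonal_one, diagonal_add, det_diagonal]
  rw [← hG, det_mul, det_mul, mul_right_comm, ← det_mul, hU', det_one, one_mul, hdet'] at hdet
  rw [← hG, ← hback J B, ← hback B B, densityHessian_conj U _ _ _ hU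
    ((isUnit_iff_isUnit_det _).1 (posDef_one_add_transpose_mul (J * U)).isUnit)]
  exact densityHessian_nonneg_of_diagonal (J * U) (B * U) _ hJ' hdet

/-! ### The area density of a linear map -/

theorem natCast_le_infty (k : ℕ) : (k : ℕ∞ω) ≤ ∞ := by
  exact_mod_cast (le_top : (k : ℕ∞) ≤ ⊤)

theorem hasDerivAt_line {F : Type*} [NormedAddCommGroup F] [NormedSpace ℝ F] (a v : F) (s : ℝ) :
    HasDerivAt (fun t : ℝ => a + t • v) v s := by
  have h := ((hasDerivAt_id s).smul_const v).const_add a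
  rwa [one_smul] at h

section MatrixCalculus

attribute [local instance] Matrix.linftyOpNormedRing Matrix.linftyOpNormedAlgebra

variable {ι : Type*} [Fintype ι] [DecidableEq ι]

theorem contDiff_det : ContDiff ℝ ∞ (fun A : Matrix ι ι ℝ => A.det) := by
  simp only [Matrix.det_apply]
  refine ContDiff.sum fun σ _ => ContDiff.const_smul _ (contDiff_prod fun i _ => ?_)
  exact (Matrix.entryLinearMap ℝ ℝ (σ i) i : Matrix ι ι ℝ →ₗ[ℝ] ℝ).toContinuousLinearMap.contDiff

theorem fderiv_det (A N : Matrix ι ι ℝ) (hA : IsUnit A.det) :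
    fderiv ℝ (fun A : Matrix ι ι ℝ => A.det) A N = A.det * (A⁻¹ * N).trace := by
  have h1 : HasDerivAt (fun s : ℝ => (A + s • N).det)
      (fderiv ℝ (fun A : Matrix ι ι ℝ => A.det) A N) 0 := by
    have hd : HasFDerivAt (fun A : Matrix ι ι ℝ => A.det)
        (fderiv ℝ (fun A : Matrix ι ι ℝ => A.det) A) (A + (0 : ℝ) • N) := by
      rw [zero_smul, add_zero]
      exact (contDiff_det.differentiable (by simp) A).hasFDerivAt
    exact hd.comp_hasDerivAt 0 (hasDerivAt_line A N 0)
  have h2 : HasDerivAt (fun s : ℝ => (A + s • N).det) (A.det * (A⁻¹ * N).trace) 0 := by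
    -- Factoring out `A` leaves the polynomial `det (1 + s A⁻¹N)`, whose linear coefficient is the
    -- trace; `divX.divX` carries the remainder of order `s²`.
    have e : ∀ s : ℝ, (A + s • N).det = A.det * (1 + (A⁻¹ * N).trace * s +
        ((1 + (Polynomial.X : Polynomial ℝ) • (A⁻¹ * N).map Polynomial.C).det.divX.divX).eval s
          * s ^ 2) := by
      intro s
      rw [← Matrix.det_one_add_smul, ← Matrix.det_mul, Matrix.mul_add, Matrix.mul_one,
        Matrix.mul_smul, Matrix.mul_nonsing_inv_cancel_left _ _ hA]
    simp only [e]
    set q := (1 + (Polynomial.X : Polynomial ℝ) • (A⁻¹ * N).map Polynomial.C).det.divX.divX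
    have := ((((hasDerivAt_id (0 : ℝ)).const_mul ((A⁻¹ * N).trace)).const_add 1).add
      ((q.hasDerivAt 0).mul (hasDerivAt_pow 2 (0 : ℝ)))).const_mul A.det
    simpa using this
  exact h1.unique h2

theorem hasDerivAt_inv {G : ℝ → Matrix ι ι ℝ} {G' : Matrix ι ι ℝ} {s : ℝ}
    (hG : HasDerivAt G G' s) (hu : IsUnit (G s).det) :
    HasDerivAt (fun t => (G t)⁻¹) (-((G s)⁻¹ * G' * (G s)⁻¹)) s := by
  obtain ⟨u, hu'⟩ := (Matrix.isUnit_iff_isUnit_det _).2 hu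
  have h := hasFDerivAt_ringInverse (𝕜 := ℝ) u
  rw [hu'] at h
  have := h.comp_hasDerivAt s hG
  simp only [Matrix.nonsing_inv_eq_ringInverse, ← hu', Ring.inverse_unit]
  exact this

variable {n : ℕ} {W : Type*} [NormedAddCommGroup W] [InnerProductSpace ℝ W]

/-- The matrix of inner products of the images of the standard basis under two linear maps. -/
noncomputable def mixedGram (M N : E n →L[ℝ] W) : Matrix (Fin n) (Fin n) ℝ :=
  Matrix.of fun i j => inner ℝ (M (EuclideanSpace.single i 1)) (N (EuclideanSpace.single j 1))

theorem mixedGram_add_left (M M' N : E n →L[ℝ] W) :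
    mixedGram (M + M') N = mixedGram M N + mixedGram M' N := by
  ext i j; simp [mixedGram, inner_add_left]

theorem mixedGram_smul_left (s : ℝ) (M N : E n →L[ℝ] W) :
    mixedGram (s • M) N = s • mixedGram M N := by
  ext i j; simp [mixedGram, inner_smul_left]

theorem mixedGram_add_right (M N N' : E n →L[ℝ] W) :
    mixedGram M (N + N') = mixedGram M N + mixedGram M N' := by
  ext i j; simp [mixedGram, inner_add_right]

theorem mixedGram_smul_right (s : ℝ) (M N : E n →L[ℝ] W) :
    mixedGram M (s • N) = s • mixedGram M N := by
  ext i j; simp [mixedGram, inner_smul_right]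

theorem transpose_mixedGram (M N : E n →L[ℝ] W) :
    (mixedGram M N).transpose = mixedGram N M := by
  ext i j; simp [mixedGram, real_inner_comm]

theorem mixedGram_comp (M : E n →L[ℝ] W) (Z : E n →L[ℝ] E n) :
    mixedGram M (M ∘L Z) = mixedGram M M *
      Matrix.of fun i j => Z (EuclideanSpace.single j 1) i := by
  ext i j
  have : M (Z (EuclideanSpace.single j 1)) = ∑ k, (Z (EuclideanSpace.single j 1)) k •
      M (EuclideanSpace.single k 1) := by
    conv_lhs => rw [← (EuclideanSpace.basisFun (Fin n) ℝ).sum_repr (Z (EuclideanSpace.single j 1))]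
    simp
  simp only [mixedGram, Matrix.of_apply, Matrix.mul_apply, ContinuousLinearMap.comp_apply, this,
    inner_sum, inner_smul_right]
  exact Finset.sum_congr rfl fun k _ => mul_comm _ _

theorem contDiff_mixedGram : ContDiff ℝ ∞ fun M : E n →L[ℝ] W => mixedGram M M := by
  have e : ∀ M : E n →L[ℝ] W, mixedGram M M = ∑ i, ∑ j,
      (inner ℝ (M (EuclideanSpace.single i 1)) (M (EuclideanSpace.single j 1)) : ℝ) •
        Matrix.single i j (1 : ℝ) := by
    intro M
    conv_lhs => rw [Matrix.matrix_eq_sum_single (mixedGram M M)]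
    simp [mixedGram]
  simp only [e]
  exact ContDiff.sum fun i _ => ContDiff.sum fun j _ =>
    (ContDiff.inner ℝ (by fun_prop) (by fun_prop)).smul contDiff_const

theorem hasDerivAt_mixedGram_line (M N : E n →L[ℝ] W) :
    HasDerivAt (fun s : ℝ => mixedGram (M + s • N) (M + s • N))
      (mixedGram M N + (mixedGram M N).transpose) 0 := by
  have e : ∀ s : ℝ, mixedGram (M + s • N) (M + s • N) = mixedGram M M +
      s • (mixedGram M N + mixedGram N M) + s ^ 2 • mixedGram N N := by
    intro s
    simp only [mixedGram_add_left, mixedGram_add_right, mixedGram_smul_left,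
      mixedGram_smul_right, smul_add, smul_smul, pow_two]
    abel
  simp only [e, transpose_mixedGram]
  have := (hasDerivAt_line (mixedGram M M) (mixedGram M N + mixedGram N M) 0).add
    ((hasDerivAt_pow 2 (0 : ℝ)).smul_const (mixedGram N N))
  exact this.congr_deriv (by simp)

/-- The factor by which a linear map scales volume. -/
noncomputable def areaDensity (M : E n →L[ℝ] W) : ℝ := Real.sqrt (mixedGram M M).det

/-- The trace of an endomorphism of Euclidean space. -/
noncomputable def euclideanTrace (Z : E n →L[ℝ] E n) : ℝ := ∑ i, Z (EuclideanSpace.single i 1) i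

theorem contDiffAt_areaDensity {M : E n →L[ℝ] W} (hM : 0 < (mixedGram M M).det) :
    ContDiffAt ℝ ∞ areaDensity M :=
  (contDiff_det.comp contDiff_mixedGram).contDiffAt.sqrt hM.ne'

theorem continuous_det_mixedGram : Continuous fun M : E n →L[ℝ] W => (mixedGram M M).det :=
  (contDiff_det.comp contDiff_mixedGram).continuous

theorem eventually_det_mixedGram_pos {M : E n →L[ℝ] W} (hM : 0 < (mixedGram M M).det) :
    ∀ᶠ M' in 𝓝 M, 0 < (mixedGram M' M').det :=
  continuous_det_mixedGram.continuousAt.eventually (lt_mem_nhds hM)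

theorem fderiv_areaDensity {M : E n →L[ℝ] W} (hM : 0 < (mixedGram M M).det)
    (N : E n →L[ℝ] W) : fderiv ℝ areaDensity M N =
      areaDensity M * ((mixedGram M M)⁻¹ * mixedGram M N).trace := by
  have h1 : HasDerivAt (fun s : ℝ => areaDensity (M + s • N)) (fderiv ℝ areaDensity M N) 0 := by
    have hd : HasFDerivAt areaDensity (fderiv ℝ areaDensity M) (M + (0 : ℝ) • N) := by
      rw [zero_smul, add_zero]
      exact ((contDiffAt_areaDensity hM).differentiableAt (by simp)).hasFDerivAt
    exact hd.comp_hasDerivAt 0 (hasDerivAt_line M N 0)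
  have h0 : mixedGram (M + (0 : ℝ) • N) (M + (0 : ℝ) • N) = mixedGram M M := by
    rw [zero_smul, add_zero]
  have hu : IsUnit (mixedGram M M).det := isUnit_iff_ne_zero.2 hM.ne'
  have hdet : HasDerivAt (fun s : ℝ => (mixedGram (M + s • N) (M + s • N)).det)
      ((mixedGram M M).det *
        ((mixedGram M M)⁻¹ * (mixedGram M N + (mixedGram M N).transpose)).trace) 0 := by
    have hd := (contDiff_det.differentiable (by simp)
      (mixedGram (M + (0 : ℝ) • N) (M + (0 : ℝ) • N))).hasFDerivAt
    have := hd.comp_hasDerivAt 0 (hasDerivAt_mixedGram_line M N)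
    rw [h0] at this
    exact this.congr_deriv (fderiv_det _ _ hu)
  have h2 := hdet.sqrt (by rw [h0]; exact hM.ne')
  rw [h0] at h2
  rw [h1.unique h2]
  have htr : ((mixedGram M M)⁻¹ * (mixedGram M N).transpose).trace =
      ((mixedGram M M)⁻¹ * mixedGram M N).trace := by
    rw [← Matrix.trace_transpose, Matrix.transpose_mul, Matrix.transpose_transpose,
      Matrix.transpose_nonsing_inv, transpose_mixedGram, Matrix.trace_mul_comm]
  rw [Matrix.mul_add, Matrix.trace_add, htr, areaDensity]
  have hs := Real.sqrt_pos.2 hM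
  field_simp
  rw [Real.sq_sqrt hM.le]
  ring

/-- Infinitesimal form of `a(M ∘ A) = |det A| a(M)` at `A = 1 + s Z`. -/
theorem fderiv_areaDensity_comp {M : E n →L[ℝ] W} (hM : 0 < (mixedGram M M).det)
    (Z : E n →L[ℝ] E n) :
    fderiv ℝ areaDensity M (M ∘L Z) = areaDensity M * euclideanTrace Z := by
  rw [fderiv_areaDensity hM, mixedGram_comp,
    Matrix.nonsing_inv_mul_cancel_left _ _ (isUnit_iff_ne_zero.2 hM.ne')]
  rfl

theorem differentiableAt_fderiv_areaDensity {M : E n →L[ℝ] W} (hM : 0 < (mixedGram M M).det) :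
    DifferentiableAt ℝ (fderiv ℝ areaDensity) M :=
  ((contDiffAt_areaDensity hM).fderiv_right (m := 1) (natCast_le_infty 2)).differentiableAt (by simp)

theorem sndFDeriv_areaDensity_symm {M : E n →L[ℝ] W} (hM : 0 < (mixedGram M M).det)
    (N N' : E n →L[ℝ] W) : fderiv ℝ (fderiv ℝ areaDensity) M N N' =
      fderiv ℝ (fderiv ℝ areaDensity) M N' N :=
  ((contDiffAt_areaDensity hM).isSymmSndFDerivAt (by simpa using natCast_le_infty 2)).eq N N'

/-- Derivative in `M`, along `N`, of the identity `fderiv_areaDensity_comp`, which holds on a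
neighbourhood of `M`. -/
theorem sndFDeriv_areaDensity_comp {M : E n →L[ℝ] W} (hM : 0 < (mixedGram M M).det)
    (N : E n →L[ℝ] W) (Z : E n →L[ℝ] E n) :
    fderiv ℝ (fderiv ℝ areaDensity) M N (M ∘L Z) + fderiv ℝ areaDensity M (N ∘L Z) =
      fderiv ℝ areaDensity M N * euclideanTrace Z := by
  have hd := (differentiableAt_fderiv_areaDensity hM).hasFDerivAt
  have hcomp : HasFDerivAt (fun M' : E n →L[ℝ] W => M' ∘L Z)
      ((ContinuousLinearMap.compL ℝ (E n) (E n) W).flip Z) M :=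
    ((ContinuousLinearMap.compL ℝ (E n) (E n) W).flip Z).hasFDerivAt
  have h1 := hd.clm_apply hcomp
  have h2 : HasFDerivAt (fun M' : E n →L[ℝ] W => fderiv ℝ areaDensity M' (M' ∘L Z))
      (euclideanTrace Z • fderiv ℝ areaDensity M) M := by
    have h := ((contDiffAt_areaDensity hM).differentiableAt (by simp)).hasFDerivAt.mul_const
      (euclideanTrace Z)
    refine h.congr_of_eventuallyEq ?_
    filter_upwards [eventually_det_mixedGram_pos hM] with M' hM'
    exact fderiv_areaDensity_comp hM' Z
  have := congrArg (fun T => T N) (h1.unique h2)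
  simp at this
  linarith

theorem sndFDeriv_areaDensity_self {M : E n →L[ℝ] W} (hM : 0 < (mixedGram M M).det)
    (N : E n →L[ℝ] W) : fderiv ℝ (fderiv ℝ areaDensity) M N N =
      areaDensity M * densityHessian (mixedGram M M) (mixedGram M N) (mixedGram N N) := by
  have hM0 : 0 < (mixedGram (M + (0 : ℝ) • N) (M + (0 : ℝ) • N)).det := by
    rwa [zero_smul, add_zero]
  have hline := hasDerivAt_line M N 0
  have h1 : HasDerivAt (fun s : ℝ => fderiv ℝ areaDensity (M + s • N) N)
      (fderiv ℝ (fderiv ℝ areaDensity) M N N) 0 := by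
    have hd := (differentiableAt_fderiv_areaDensity hM0).hasFDerivAt
    have hd' : HasDerivAt (fun s : ℝ => fderiv ℝ areaDensity (M + s • N))
        (fderiv ℝ (fderiv ℝ areaDensity) (M + (0 : ℝ) • N) N) 0 :=
      HasFDerivAt.comp_hasDerivAt (l := fderiv ℝ areaDensity) (f := fun s : ℝ => M + s • N)
        0 hd hline
    have := hd'.clm_apply (hasDerivAt_const (0 : ℝ) N)
    simpa using this
  have hp : HasDerivAt (fun s : ℝ => areaDensity (M + s • N)) (fderiv ℝ areaDensity M N) 0 := by
    have hd := ((contDiffAt_areaDensity hM0).differentiableAt (by simp)).hasFDerivAt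
    have := hd.comp_hasDerivAt 0 hline
    rw [zero_smul, add_zero] at this
    exact this
  have hinv := hasDerivAt_inv (hasDerivAt_mixedGram_line M N) (isUnit_iff_ne_zero.2 hM0.ne')
  have hC : HasDerivAt (fun s : ℝ => mixedGram (M + s • N) N) (mixedGram N N) 0 := by
    simp only [mixedGram_add_left, mixedGram_smul_left]
    exact hasDerivAt_line _ _ _
  have htr : HasDerivAt (fun s : ℝ => ((mixedGram (M + s • N) (M + s • N))⁻¹ *
      mixedGram (M + s • N) N).trace)
      (-((mixedGram (M + (0 : ℝ) • N) (M + (0 : ℝ) • N))⁻¹ *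
          (mixedGram M N + (mixedGram M N).transpose) *
          (mixedGram (M + (0 : ℝ) • N) (M + (0 : ℝ) • N))⁻¹) * mixedGram (M + (0 : ℝ) • N) N +
        (mixedGram (M + (0 : ℝ) • N) (M + (0 : ℝ) • N))⁻¹ * mixedGram N N).trace 0 :=
    (Matrix.traceLinearMap (Fin n) ℝ ℝ).toContinuousLinearMap.hasFDerivAt.comp_hasDerivAt 0
      (hinv.mul hC)
  have h2 := hp.mul htr
  have hev : (fun s : ℝ => fderiv ℝ areaDensity (M + s • N) N) =ᶠ[𝓝 0]
      ((fun s : ℝ => areaDensity (M + s • N)) * fun s : ℝ =>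
        ((mixedGram (M + s • N) (M + s • N))⁻¹ * mixedGram (M + s • N) N).trace) := by
    filter_upwards [hline.continuousAt.eventually (eventually_det_mixedGram_pos hM0)] with s hs
    exact fderiv_areaDensity hs N
  refine (h1.unique (h2.congr_of_eventuallyEq hev)).trans ?_
  simp only [zero_smul, add_zero, fderiv_areaDensity hM, densityHessian,
    Matrix.trace_add, Matrix.neg_mul, Matrix.trace_neg]
  ring

end MatrixCalculus

/-! ### Divergence theorem and differentiation under the integral sign -/

/-- The divergence of a vector field on Euclidean space. -/
noncomputable def divergence {n : ℕ} (z : E n → E n) (x : E n) : ℝ :=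
  euclideanTrace (fderiv ℝ z x)

theorem fderiv_euclidean_apply {F ι : Type*} [NormedAddCommGroup F] [NormedSpace ℝ F] [Fintype ι]
    {g : F → EuclideanSpace ℝ ι} {x : F} (hg : DifferentiableAt ℝ g x) (v : F) (i : ι) :
    fderiv ℝ g x v i = fderiv ℝ (fun w => g w i) x v := by
  have h := ((EuclideanSpace.proj i : EuclideanSpace ℝ ι →L[ℝ] ℝ).hasFDerivAt (x := g x)).comp x
    hg.hasFDerivAt
  have h' : fderiv ℝ (fun w => g w i) x = (EuclideanSpace.proj i : EuclideanSpace ℝ ι →L[ℝ] ℝ) ∘L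
    fderiv ℝ g x := h.fderiv
  rw [h']
  rfl

theorem integral_fderiv_apply_eq_zero {n : ℕ} {g : E n → ℝ} (hg : ContDiff ℝ 1 g)
    (hc : HasCompactSupport g) (v : E n) : ∫ x, fderiv ℝ g x v = 0 := by
  have hc' : HasCompactSupport fun x => fderiv ℝ g x v := hc.fderiv_apply ℝ v
  have hcont : Continuous fun x => fderiv ℝ g x v :=
    (hg.continuous_fderiv (by simp)).clm_apply continuous_const
  have := integral_mul_fderiv_eq_neg_fderiv_mul_of_integrable (μ := volume)
    (f := fun _ : E n => (1 : ℝ)) (g := g) (v := v) (by simp)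
    (by simpa using hcont.integrable_of_hasCompactSupport hc')
    (by simpa using hg.continuous.integrable_of_hasCompactSupport hc)
    (fun x _ => differentiableAt_const _) (fun x _ => hg.differentiable (by simp) x)
  simpa using this

/-- No regularity of `K` is needed: `D` and the complement of `K` form an open cover, so `z`
extended by zero is `C¹` with compact support, and each `∂ᵢzᵢ` integrates to zero over the whole
space. -/
theorem setIntegral_divergence_eq_zero {n : ℕ} {D K : Set (E n)} (hD : IsOpen D)
    (hK : IsCompact K) (hKD : K ⊆ D) {z : E n → E n} (hz : ContDiffOn ℝ 1 z D)
    (h0 : ∀ x ∈ D \ K, z x = 0) : ∫ x in K, divergence z x = 0 := by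
  set y : E n → E n := D.indicator z with hy
  have hyK : ∀ x ∉ K, y x = 0 := by
    intro x hx
    by_cases hxD : x ∈ D
    · rw [hy, indicator_of_mem hxD, h0 x ⟨hxD, hx⟩]
    · rw [hy, indicator_of_notMem hxD]
  have hyD : ∀ x ∈ D, y =ᶠ[𝓝 x] z := fun x hx => by
    filter_upwards [hD.mem_nhds hx] with w hw using indicator_of_mem hw z
  have hyK' : ∀ x ∉ K, y =ᶠ[𝓝 x] fun _ => 0 := fun x hx => by
    filter_upwards [hK.isClosed.isOpen_compl.mem_nhds hx] with w hw using hyK w hw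
  have hsmooth : ContDiff ℝ 1 y := contDiff_iff_contDiffAt.2 fun x => by
    by_cases hx : x ∈ D
    · exact (hz.contDiffAt (hD.mem_nhds hx)).congr_of_eventuallyEq (hyD x hx)
    · exact contDiffAt_const.congr_of_eventuallyEq (hyK' x fun h => hx (hKD h))
  have hcs : HasCompactSupport y := HasCompactSupport.intro hK hyK
  have hcoord : ∀ i : Fin n, ContDiff ℝ 1 fun x => y x i := fun i => by fun_prop
  have hcsi : ∀ i : Fin n, HasCompactSupport fun x => y x i := fun i =>
    HasCompactSupport.intro hK fun x hx => by simp [hyK x hx]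
  have hfd : ∀ x v (i : Fin n), fderiv ℝ y x v i = fderiv ℝ (fun w => y w i) x v :=
    fun x v i => fderiv_euclidean_apply (hsmooth.differentiable (by simp) x) v i
  have e1 : ∫ x in K, divergence z x = ∫ x in K, divergence y x := by
    refine setIntegral_congr_fun hK.measurableSet fun x hx => ?_
    simp only [divergence, (hyD x (hKD hx)).fderiv_eq]
  have e2 : ∫ x in K, divergence y x = ∫ x, divergence y x := by
    refine setIntegral_eq_integral_of_forall_compl_eq_zero fun x hx => ?_
    rw [divergence, (hyK' x hx).fderiv_eq]
    simp [euclideanTrace]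
  rw [e1, e2]
  simp only [divergence, euclideanTrace, hfd]
  rw [integral_finsetSum]
  · exact Finset.sum_eq_zero fun i _ => integral_fderiv_apply_eq_zero (hcoord i) (hcsi i) _
  · intro i _
    exact (((hcoord i).continuous_fderiv (by simp)).clm_apply
      continuous_const).integrable_of_hasCompactSupport ((hcsi i).fderiv_apply ℝ _)

/-! ### Time and space derivatives of one-parameter families -/

section TimeDerivative

variable {n : ℕ} {W : Type*} [NormedAddCommGroup W] [NormedSpace ℝ W]

/-- The derivative in the time variable. -/
noncomputable def timeD (Φ : ℝ × E n → W) (p : ℝ × E n) : W := fderiv ℝ Φ p (1, 0)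

/-- The derivative in the space variable. -/
noncomputable def spaceD (Φ : ℝ × E n → W) (p : ℝ × E n) : E n →L[ℝ] W :=
  fderiv ℝ Φ p ∘L ContinuousLinearMap.inr ℝ ℝ (E n)

theorem contDiffOn_fderiv {F : Type*} [NormedAddCommGroup F] [NormedSpace ℝ F] {Φ : F → W}
    {O : Set F} (h : ContDiffOn ℝ ∞ Φ O) (hO : IsOpen O) : ContDiffOn ℝ ∞ (fderiv ℝ Φ) O :=
  h.fderiv_of_isOpen hO (by simp)

theorem contDiffOn_timeD {Φ : ℝ × E n → W} {O : Set (ℝ × E n)} (h : ContDiffOn ℝ ∞ Φ O)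
    (hO : IsOpen O) : ContDiffOn ℝ ∞ (timeD Φ) O :=
  (contDiffOn_fderiv h hO).clm_apply contDiffOn_const

theorem contDiffOn_spaceD {Φ : ℝ × E n → W} {O : Set (ℝ × E n)} (h : ContDiffOn ℝ ∞ Φ O)
    (hO : IsOpen O) : ContDiffOn ℝ ∞ (spaceD Φ) O :=
  (contDiffOn_fderiv h hO).clm_comp contDiffOn_const

theorem hasDerivAt_timeD {Φ : ℝ × E n → W} {s : ℝ} {x : E n}
    (h : DifferentiableAt ℝ Φ (s, x)) : HasDerivAt (fun t => Φ (t, x)) (timeD Φ (s, x)) s :=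
  h.hasFDerivAt.comp_hasDerivAt s ((hasDerivAt_id s).prodMk (hasDerivAt_const s x))

theorem hasFDerivAt_spaceD {Φ : ℝ × E n → W} {s : ℝ} {x : E n}
    (h : DifferentiableAt ℝ Φ (s, x)) : HasFDerivAt (fun y => Φ (s, y)) (spaceD Φ (s, x)) x :=
  h.hasFDerivAt.comp x (hasFDerivAt_prodMk_right s x)

theorem hasDerivAt_spaceD {Φ : ℝ × E n → W} {O : Set (ℝ × E n)} (h : ContDiffOn ℝ ∞ Φ O)
    (hO : IsOpen O) {s : ℝ} {x : E n} (hp : (s, x) ∈ O) :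
    HasDerivAt (fun t => spaceD Φ (t, x)) (spaceD (timeD Φ) (s, x)) s := by
  have hat := h.contDiffAt (hO.mem_nhds hp)
  have hd := ((contDiffOn_fderiv h hO).contDiffAt (hO.mem_nhds hp)).differentiableAt (by simp)
  have h1 := hasDerivAt_timeD (((contDiffOn_spaceD h hO).contDiffAt (hO.mem_nhds hp)).differentiableAt
    (by simp))
  refine h1.congr_deriv ?_
  ext1 v
  have hsymm := (hat.isSymmSndFDerivAt (by simpa using natCast_le_infty 2)).eq
    ((1, 0) : ℝ × E n) (0, v)
  have e1 : timeD (spaceD Φ) (s, x) v = fderiv ℝ (fderiv ℝ Φ) (s, x) (1, 0) (0, v) := by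
    have := hd.hasFDerivAt.clm_comp
      (hasFDerivAt_const (ContinuousLinearMap.inr ℝ ℝ (E n)) ((s, x) : ℝ × E n))
    have e : fderiv ℝ (spaceD Φ) (s, x) = _ := this.fderiv
    rw [timeD, e]
    simp
  have e2 : spaceD (timeD Φ) (s, x) v = fderiv ℝ (fderiv ℝ Φ) (s, x) (0, v) (1, 0) := by
    have := hd.hasFDerivAt.clm_apply (hasFDerivAt_const ((1, 0) : ℝ × E n) ((s, x) : ℝ × E n))
    have e : fderiv ℝ (timeD Φ) (s, x) = _ := this.fderiv
    rw [spaceD, e]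
    simp
  rw [e1, e2, hsymm]

theorem exists_tube {O : Set (ℝ × E n)} (hO : IsOpen O) {K : Set (E n)} (hK : IsCompact K)
    {s : ℝ} (hs : ∀ x ∈ K, (s, x) ∈ O) :
    ∃ δ > 0, ∀ t ∈ Metric.closedBall s δ, ∀ x ∈ K, (t, x) ∈ O := by
  obtain ⟨U, V, hU, -, hsU, hKV, hUV⟩ := generalized_tube_lemma (isCompact_singleton (x := s)) hK hO
    (fun p hp => by
      obtain ⟨h1, h2⟩ := hp
      rw [mem_singleton_iff] at h1
      have := hs p.2 h2
      rwa [← h1] at this)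
  obtain ⟨δ, hδ, hball⟩ := Metric.nhds_basis_closedBall.mem_iff.1 (hU.mem_nhds (hsU rfl))
  exact ⟨δ, hδ, fun t ht x hx => hUV ⟨hball ht, hKV hx⟩⟩

theorem hasDerivAt_setIntegral {q : ℝ × E n → ℝ} {O : Set (ℝ × E n)} (hO : IsOpen O)
    (hq : ContDiffOn ℝ ∞ q O) {K : Set (E n)} (hK : IsCompact K) {s : ℝ}
    (hs : ∀ x ∈ K, (s, x) ∈ O) :
    HasDerivAt (fun t => ∫ x in K, q (t, x)) (∫ x in K, timeD q (s, x)) s := by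
  obtain ⟨δ, hδ, htube⟩ := exists_tube hO hK hs
  have hcont : ∀ g : ℝ × E n → ℝ, ContinuousOn g O → ∀ t ∈ Metric.closedBall s δ,
      ContinuousOn (fun x => g (t, x)) K := fun g hg t ht =>
    hg.comp (by fun_prop) fun x hx => htube t ht x hx
  have hs0 : s ∈ Metric.closedBall s δ := Metric.mem_closedBall_self hδ.le
  have htc : ContinuousOn (timeD q) O := (contDiffOn_timeD hq hO).continuousOn
  obtain ⟨C, hC⟩ := ((isCompact_closedBall s δ).prod hK).exists_bound_of_continuousOn
    (htc.mono fun p hp => htube p.1 hp.1 p.2 hp.2)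
  refine (hasDerivAt_integral_of_dominated_loc_of_deriv_le (μ := volume.restrict K)
    (F := fun t x => q (t, x)) (F' := fun t x => timeD q (t, x)) (s := Metric.closedBall s δ)
    (bound := fun _ => C) (Metric.closedBall_mem_nhds s hδ) ?_ ?_ ?_ ?_ ?_ ?_).2
  · filter_upwards [Metric.closedBall_mem_nhds s hδ] with t ht
    exact (hcont q hq.continuousOn t ht).aestronglyMeasurable hK.measurableSet
  · exact (hcont q hq.continuousOn s hs0).integrableOn_compact hK
  · exact (hcont _ htc s hs0).aestronglyMeasurable hK.measurableSet
  · filter_upwards [ae_restrict_mem hK.measurableSet] with x hx t ht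
    exact hC (t, x) ⟨ht, hx⟩
  · exact (continuousOn_const (c := C)).integrableOn_compact hK
  · filter_upwards [ae_restrict_mem hK.measurableSet] with x hx t ht
    exact hasDerivAt_timeD ((hq.contDiffAt (hO.mem_nhds (htube t ht x hx))).differentiableAt
      (by simp))

theorem second_deriv_setIntegral {q : ℝ × E n → ℝ} {O : Set (ℝ × E n)} (hO : IsOpen O)
    (hq : ContDiffOn ℝ ∞ q O) {K : Set (E n)} (hK : IsCompact K) {I : ℝ → ℝ}
    (hI : I =ᶠ[𝓝 0] fun t => ∫ x in K, q (t, x)) (hs : ∀ x ∈ K, ((0 : ℝ), x) ∈ O) :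
    (∀ᶠ s in 𝓝 (0 : ℝ), DifferentiableAt ℝ I s) ∧
      HasDerivAt (deriv I) (∫ x in K, timeD (timeD q) (0, x)) 0 := by
  obtain ⟨δ, hδ, htube⟩ := exists_tube hO hK hs
  have hev : ∀ᶠ s in 𝓝 (0 : ℝ), HasDerivAt I (∫ x in K, timeD q (s, x)) s := by
    filter_upwards [Metric.closedBall_mem_nhds (0 : ℝ) hδ, hI.eventually_nhds] with s h1 h2
    exact (hasDerivAt_setIntegral hO hq hK (htube s h1)).congr_of_eventuallyEq h2
  refine ⟨hev.mono fun s h => h.differentiableAt, ?_⟩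
  exact (hasDerivAt_setIntegral hO (contDiffOn_timeD hq hO) hK hs).congr_of_eventuallyEq
    (hev.mono fun s h => h.deriv)

end TimeDerivative

/-! ### First and second variation of area -/

section Variation

variable {n : ℕ} {W : Type*} [NormedAddCommGroup W] [InnerProductSpace ℝ W]

theorem divergence_smul {φ : E n → ℝ} {X : E n → E n} {x : E n} (hφ : DifferentiableAt ℝ φ x)
    (hX : DifferentiableAt ℝ X x) : divergence (fun y => φ y • X y) x =
      fderiv ℝ φ x (X x) + φ x * euclideanTrace (fderiv ℝ X x) := by
  have h : fderiv ℝ (fun y => φ y • X y) x = _ := (hφ.hasFDerivAt.smul hX.hasFDerivAt).fderiv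
  have hX' : fderiv ℝ φ x (X x) =
      ∑ i, fderiv ℝ φ x (EuclideanSpace.single i 1) * X x i := by
    conv_lhs => rw [← (EuclideanSpace.basisFun (Fin n) ℝ).sum_repr (X x)]
    simp [mul_comm]
  rw [divergence, h, hX']
  simp [euclideanTrace, Finset.sum_add_distrib, Finset.mul_sum, add_comm]

theorem fderiv_fderiv_apply {F : E n → W} {X : E n → E n} {x : E n} (hF : ContDiffAt ℝ ∞ F x)
    (hX : DifferentiableAt ℝ X x) : fderiv ℝ (fun y => fderiv ℝ F y (X y)) x =
      fderiv ℝ (fderiv ℝ F) x (X x) + fderiv ℝ F x ∘L fderiv ℝ X x := by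
  have hd : DifferentiableAt ℝ (fderiv ℝ F) x :=
    (hF.fderiv_right (m := 1) (natCast_le_infty 2)).differentiableAt (by simp)
  have h : fderiv ℝ (fun y => fderiv ℝ F y (X y)) x = _ :=
    (hd.hasFDerivAt.clm_apply hX.hasFDerivAt).fderiv
  rw [h]
  ext1 v
  have hsymm := (hF.isSymmSndFDerivAt (by simpa using natCast_le_infty 2)).eq v (X x)
  simp [hsymm, add_comm]

variable {D K : Set (E n)} {F : E n → W}

/-- A smooth immersion of an open set. -/
structure IsImmersionOn (F : E n → W) (D : Set (E n)) : Prop where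
  isOpen : IsOpen D
  smooth : ContDiffOn ℝ ∞ F D
  det_pos : ∀ x ∈ D, 0 < (mixedGram (fderiv ℝ F x) (fderiv ℝ F x)).det

namespace IsImmersionOn

theorem contDiffAt (h : IsImmersionOn F D) {x : E n} (hx : x ∈ D) : ContDiffAt ℝ ∞ F x :=
  h.smooth.contDiffAt (h.isOpen.mem_nhds hx)

theorem contDiffOn_density (h : IsImmersionOn F D) :
    ContDiffOn ℝ ∞ (fun x => areaDensity (fderiv ℝ F x)) D := fun x hx =>
  (contDiffAt_areaDensity (h.det_pos x hx)).comp_contDiffWithinAt x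
    (contDiffOn_fderiv h.smooth h.isOpen x hx)

theorem contDiffOn_fderiv_density (h : IsImmersionOn F D) :
    ContDiffOn ℝ ∞ (fun x => fderiv ℝ areaDensity (fderiv ℝ F x)) D := fun x hx =>
  ((contDiffAt_areaDensity (h.det_pos x hx)).fderiv_right (m := ∞) (by simp)).comp_contDiffWithinAt
    x (contDiffOn_fderiv h.smooth h.isOpen x hx)

/-- By `fderiv_fderiv_apply`, `d(dF·X)` is the derivative of `dF` along `X` plus `dF ∘ dX`. The
former contributes the derivative of the density along `X`, the latter the density times the
divergence of `X`. -/
theorem firstVariation_tangential (h : IsImmersionOn F D) {X : E n → E n} {x : E n} (hx : x ∈ D)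
    (hX : DifferentiableAt ℝ X x) :
    fderiv ℝ areaDensity (fderiv ℝ F x) (fderiv ℝ (fun y => fderiv ℝ F y (X y)) x) =
      divergence (fun y => areaDensity (fderiv ℝ F y) • X y) x := by
  have hF := h.contDiffAt hx
  have hdF : DifferentiableAt ℝ (fderiv ℝ F) x :=
    (hF.fderiv_right (m := 1) (natCast_le_infty 2)).differentiableAt (by simp)
  have hp := (contDiffAt_areaDensity (h.det_pos x hx)).differentiableAt (by simp)
  have hcomp := hp.hasFDerivAt.comp x hdF.hasFDerivAt
  have hcomp' : fderiv ℝ (fun y => areaDensity (fderiv ℝ F y)) x = _ := hcomp.fderiv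
  rw [divergence_smul (φ := fun y => areaDensity (fderiv ℝ F y)) hcomp.differentiableAt hX,
    fderiv_fderiv_apply hF hX, map_add, fderiv_areaDensity_comp (h.det_pos x hx), hcomp']
  rfl

/-- With the same splitting, the first term is the derivative of `Da(dF)(dY)` along `X` minus
`Da(dF)(D²Y(X))`. By `sndFDeriv_areaDensity_comp` the second is `Da(dF)(dY) div X - Da(dF)(dY ∘
dX)`. The two subtracted terms combine to `Da(dF)(d(dY·X))`. -/
theorem secondVariation_tangential (h : IsImmersionOn F D) {X : E n → E n} {Y : E n → W}
    {x : E n} (hx : x ∈ D) (hX : DifferentiableAt ℝ X x) (hY : ContDiffAt ℝ ∞ Y x) :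
    fderiv ℝ (fderiv ℝ areaDensity) (fderiv ℝ F x) (fderiv ℝ Y x)
        (fderiv ℝ (fun y => fderiv ℝ F y (X y)) x) =
      divergence (fun y => fderiv ℝ areaDensity (fderiv ℝ F y) (fderiv ℝ Y y) • X y) x -
        fderiv ℝ areaDensity (fderiv ℝ F x) (fderiv ℝ (fun y => fderiv ℝ Y y (X y)) x) := by
  have hF := h.contDiffAt hx
  have hdF : DifferentiableAt ℝ (fderiv ℝ F) x :=
    (hF.fderiv_right (m := 1) (natCast_le_infty 2)).differentiableAt (by simp)
  have hdY : DifferentiableAt ℝ (fderiv ℝ Y) x :=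
    (hY.fderiv_right (m := 1) (natCast_le_infty 2)).differentiableAt (by simp)
  have hp := (differentiableAt_fderiv_areaDensity (h.det_pos x hx)).hasFDerivAt
  have hpF : HasFDerivAt (fun y => fderiv ℝ areaDensity (fderiv ℝ F y))
      (fderiv ℝ (fderiv ℝ areaDensity) (fderiv ℝ F x) ∘L fderiv ℝ (fderiv ℝ F) x) x :=
    HasFDerivAt.comp (g := fderiv ℝ areaDensity) (f := fderiv ℝ F) x hp hdF.hasFDerivAt
  have hcomp := hpF.clm_apply hdY.hasFDerivAt
  have hcomp' : fderiv ℝ (fun y => fderiv ℝ areaDensity (fderiv ℝ F y) (fderiv ℝ Y y)) x = _ :=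
    hcomp.fderiv
  have hmix := sndFDeriv_areaDensity_comp (h.det_pos x hx) (fderiv ℝ Y x) (fderiv ℝ X x)
  have hsymm := sndFDeriv_areaDensity_symm (h.det_pos x hx) (fderiv ℝ Y x)
    (fderiv ℝ (fderiv ℝ F) x (X x))
  have hdiv := divergence_smul (φ := fun y => fderiv ℝ areaDensity (fderiv ℝ F y) (fderiv ℝ Y y))
    hcomp.differentiableAt hX
  rw [hdiv, fderiv_fderiv_apply hF hX, fderiv_fderiv_apply hY hX, map_add, map_add, hcomp', hsymm]
  simp only [_root_.add_apply, ContinuousLinearMap.comp_apply,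
    ContinuousLinearMap.flip_apply]
  linarith

end IsImmersionOn

/-! ### Tangential projection along an immersion -/

section Projection

attribute [local instance] Matrix.linftyOpNormedRing Matrix.linftyOpNormedAlgebra

theorem IsImmersionOn.contDiffOn_inv (h : IsImmersionOn F D) (i j : Fin n) :
    ContDiffOn ℝ ∞ (fun x => (mixedGram (fderiv ℝ F x) (fderiv ℝ F x))⁻¹ i j) D := by
  intro x hx
  have hu := (Matrix.isUnit_iff_isUnit_det _).2 (isUnit_iff_ne_zero.2 (h.det_pos x hx).ne')
  obtain ⟨u, hu⟩ := hu
  have hr := contDiffAt_ringInverse ℝ (n := ∞) u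
  rw [hu] at hr
  have hg : ContDiffWithinAt ℝ ∞ (fun x => mixedGram (fderiv ℝ F x) (fderiv ℝ F x)) D x :=
    contDiff_mixedGram.contDiffAt.comp_contDiffWithinAt x
      (contDiffOn_fderiv h.smooth h.isOpen x hx)
  have hc := hr.comp_contDiffWithinAt x hg
  have he : ContDiff ℝ ∞ fun A : Matrix (Fin n) (Fin n) ℝ => A i j :=
    (Matrix.entryLinearMap ℝ ℝ i j :
      Matrix (Fin n) (Fin n) ℝ →ₗ[ℝ] ℝ).toContinuousLinearMap.contDiff
  simp only [Matrix.nonsing_inv_eq_ringInverse]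
  exact he.contDiffAt.comp_contDiffWithinAt x hc

end Projection

/-- The coordinates of the tangential part of the vector field `w` along `F`. -/
noncomputable def tangentialCoord (F w : E n → W) (x : E n) : E n :=
  WithLp.toLp 2 fun i => ∑ j, (mixedGram (fderiv ℝ F x) (fderiv ℝ F x))⁻¹ i j *
    inner ℝ (fderiv ℝ F x (EuclideanSpace.single j 1)) (w x)

theorem IsImmersionOn.contDiffOn_tangentialCoord (h : IsImmersionOn F D) {w : E n → W}
    (hw : ContDiffOn ℝ ∞ w D) : ContDiffOn ℝ ∞ (tangentialCoord F w) D := by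
  refine contDiffOn_euclidean.2 fun i => ?_
  simp only [tangentialCoord]
  exact ContDiffOn.sum fun j _ => (h.contDiffOn_inv i j).mul
    (ContDiffOn.inner ℝ ((contDiffOn_fderiv h.smooth h.isOpen).clm_apply contDiffOn_const) hw)

theorem clm_apply_eq_sum {V : Type*} [NormedAddCommGroup V] [NormedSpace ℝ V] (M : E n →L[ℝ] V)
    (v : E n) : M v = ∑ k, v k • M (EuclideanSpace.single k 1) := by
  conv_lhs => rw [← (EuclideanSpace.basisFun (Fin n) ℝ).sum_repr v]
  simp

theorem inner_sub_tangentialCoord {F w : E n → W} {x : E n}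
    (hx : 0 < (mixedGram (fderiv ℝ F x) (fderiv ℝ F x)).det) (k : Fin n) :
    inner ℝ (w x - fderiv ℝ F x (tangentialCoord F w x))
      (fderiv ℝ F x (EuclideanSpace.single k 1)) = 0 := by
  set G := mixedGram (fderiv ℝ F x) (fderiv ℝ F x) with hG
  have hmul : G.mulVec (G⁻¹.mulVec fun j =>
      inner ℝ (fderiv ℝ F x (EuclideanSpace.single j 1)) (w x)) = fun j =>
      inner ℝ (fderiv ℝ F x (EuclideanSpace.single j 1)) (w x) := by
    rw [Matrix.mulVec_mulVec, Matrix.mul_nonsing_inv _ (isUnit_iff_ne_zero.2 hx.ne'),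
      Matrix.one_mulVec]
  have hk : ∑ i, G k i * tangentialCoord F w x i =
    inner ℝ (fderiv ℝ F x (EuclideanSpace.single k 1)) (w x) := congrFun hmul k
  rw [inner_sub_left, real_inner_comm, ← hk, clm_apply_eq_sum, sum_inner, sub_eq_zero]
  refine Finset.sum_congr rfl fun i _ => ?_
  rw [inner_smul_left, mul_comm, real_inner_comm]
  rfl

end Variation

/-! ### Variation formulas for minimal immersions -/

variable {n m : ℕ} {D K : Set (E n)} {F : E n → Ambient n m}

/-- Differentiating `⟨ν, ∂ⱼF⟩ = 0` gives `⟨∂ⱼF, ∂ᵢν⟩ = -⟨∂ᵢ∂ⱼF, ν⟩`, so the trace in the first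
variation is minus the mean curvature paired with `ν`. -/
theorem firstVariation_normal (h : IsImmersionOn F D) (hmin : IsMinimalOn F D)
    {ν : E n → Ambient n m} (hν : ContDiffOn ℝ ∞ ν D)
    (hn : ∀ x ∈ D, IsNormalAt F x (ν x)) {x : E n} (hx : x ∈ D) :
    fderiv ℝ areaDensity (fderiv ℝ F x) (fderiv ℝ ν x) = 0 := by
  have hF := h.contDiffAt hx
  have hdF : DifferentiableAt ℝ (fderiv ℝ F) x :=
    (hF.fderiv_right (m := 1) (natCast_le_infty 2)).differentiableAt (by simp)
  have hdν : DifferentiableAt ℝ ν x :=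
    (hν.contDiffAt (h.isOpen.mem_nhds hx)).differentiableAt (by simp)
  have hij : ∀ i j : Fin n, inner ℝ (fderiv ℝ F x (EuclideanSpace.single j 1))
      (fderiv ℝ ν x (EuclideanSpace.single i 1)) =
        -inner ℝ (partialD (partialD F j) i x) (ν x) := by
    intro i j
    have hp : DifferentiableAt ℝ (partialD F j) x :=
      hdF.clm_apply (differentiableAt_const _)
    have h0 : (fun y => inner ℝ (ν y) (partialD F j y)) =ᶠ[𝓝 x] fun _ => (0 : ℝ) := by
      filter_upwards [h.isOpen.mem_nhds hx] with y hy using hn y hy j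
    have h1 := fderiv_inner_apply ℝ hdν hp (EuclideanSpace.single i 1)
    rw [h0.fderiv_eq] at h1
    simp only [fderiv_fun_const, Pi.zero_apply, _root_.zero_apply] at h1
    rw [real_inner_comm (ν x) (partialD (partialD F j) i x), real_inner_comm]
    change inner ℝ (fderiv ℝ ν x (EuclideanSpace.single i 1)) (partialD F j x) =
      -inner ℝ (ν x) (fderiv ℝ (partialD F j) x (EuclideanSpace.single i 1))
    linarith
  have hm := hmin x hx (ν x) (hn x hx)
  have htr : ((mixedGram (fderiv ℝ F x) (fderiv ℝ F x))⁻¹ *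
      mixedGram (fderiv ℝ F x) (fderiv ℝ ν x)).trace = 0 := by
    rw [← neg_eq_zero, ← hm]
    simp only [Matrix.trace, Matrix.diag_apply, Matrix.mul_apply, ← Finset.sum_neg_distrib]
    refine Finset.sum_congr rfl fun i _ => Finset.sum_congr rfl fun j _ => ?_
    rw [show mixedGram (fderiv ℝ F x) (fderiv ℝ ν x) j i = _ from hij i j, mul_neg, neg_neg]
    rfl
  rw [fderiv_areaDensity (h.det_pos x hx), htr, mul_zero]

/-- The normal part of `w` contributes zero pointwise and the tangential part a divergence; the
tangential coordinates vanish wherever `w` does. -/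
theorem firstVariation_eq_zero (h : IsImmersionOn F D) (hmin : IsMinimalOn F D) (hK : IsCompact K)
    (hKD : K ⊆ D) {w : E n → Ambient n m} (hw : ContDiffOn ℝ ∞ w D) (h0 : ∀ x ∈ D \ K, w x = 0) :
    ∫ x in K, fderiv ℝ areaDensity (fderiv ℝ F x) (fderiv ℝ w x) = 0 := by
  set X := tangentialCoord F w with hXdef
  have hX : ContDiffOn ℝ ∞ X D := h.contDiffOn_tangentialCoord hw
  have hFX : ContDiffOn ℝ ∞ (fun y => fderiv ℝ F y (X y)) D :=
    (contDiffOn_fderiv h.smooth h.isOpen).clm_apply hX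
  have hν : ContDiffOn ℝ ∞ (fun y => w y - fderiv ℝ F y (X y)) D := hw.sub hFX
  have hpt : ∀ x ∈ D, fderiv ℝ areaDensity (fderiv ℝ F x) (fderiv ℝ w x) =
      divergence (fun y => areaDensity (fderiv ℝ F y) • X y) x := by
    intro x hx
    have hn := firstVariation_normal h hmin hν
      (fun y hy k => inner_sub_tangentialCoord (h.det_pos y hy) k) hx
    have hdw := (hw.contDiffAt (h.isOpen.mem_nhds hx)).differentiableAt (by simp)
    have hdFX := (hFX.contDiffAt (h.isOpen.mem_nhds hx)).differentiableAt (by simp)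
    rw [fderiv_fun_sub hdw hdFX, map_sub, sub_eq_zero] at hn
    rw [hn]
    exact h.firstVariation_tangential hx
      ((hX.contDiffAt (h.isOpen.mem_nhds hx)).differentiableAt (by simp))
  rw [setIntegral_congr_fun hK.measurableSet fun x hx => hpt x (hKD hx)]
  refine setIntegral_divergence_eq_zero h.isOpen hK hKD
    ((h.contDiffOn_density.smul hX).of_le (natCast_le_infty 1)) fun x hx => ?_
  have : X x = 0 := by
    ext i
    simp [hXdef, tangentialCoord, h0 x hx]
  rw [this, smul_zero]

theorem continuousOn_divergence {X : E n → E n} (hD : IsOpen D) (hX : ContDiffOn ℝ ∞ X D) :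
    ContinuousOn (divergence X) D := by
  have h := (contDiffOn_fderiv hX hD).continuousOn
  unfold divergence euclideanTrace
  exact continuousOn_finsetSum _ fun i _ => (EuclideanSpace.proj i : E n →L[ℝ] ℝ).continuous.comp_continuousOn
    (h.clm_apply continuousOn_const)

/-- Only `X` has to vanish off `K`: the divergence term and the leftover first variation along
`dY·X` both inherit this from `X`. -/
theorem secondVariation_tangential_eq_zero (h : IsImmersionOn F D) (hmin : IsMinimalOn F D)
    (hK : IsCompact K) (hKD : K ⊆ D) {X : E n → E n} (hX : ContDiffOn ℝ ∞ X D)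
    (h0 : ∀ x ∈ D \ K, X x = 0) {Y : E n → Ambient n m} (hY : ContDiffOn ℝ ∞ Y D) :
    IntegrableOn (fun x => fderiv ℝ (fderiv ℝ areaDensity) (fderiv ℝ F x) (fderiv ℝ Y x)
        (fderiv ℝ (fun y => fderiv ℝ F y (X y)) x)) K ∧
      ∫ x in K, fderiv ℝ (fderiv ℝ areaDensity) (fderiv ℝ F x) (fderiv ℝ Y x)
        (fderiv ℝ (fun y => fderiv ℝ F y (X y)) x) = 0 := by
  have hYX : ContDiffOn ℝ ∞ (fun y => fderiv ℝ Y y (X y)) D :=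
    (contDiffOn_fderiv hY h.isOpen).clm_apply hX
  have hz : ContDiffOn ℝ ∞
      (fun y => fderiv ℝ areaDensity (fderiv ℝ F y) (fderiv ℝ Y y) • X y) D :=
    (h.contDiffOn_fderiv_density.clm_apply (contDiffOn_fderiv hY h.isOpen)).smul hX
  have hpt : EqOn _ _ K := fun x hx => h.secondVariation_tangential (hKD hx)
    ((hX.contDiffAt (h.isOpen.mem_nhds (hKD hx))).differentiableAt (by simp))
    (hY.contDiffAt (h.isOpen.mem_nhds (hKD hx)))
  have hi1 := ((continuousOn_divergence h.isOpen hz).mono hKD).integrableOn_compact (μ := volume) hK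
  have hi2 := ((h.contDiffOn_fderiv_density.clm_apply
    (contDiffOn_fderiv hYX h.isOpen)).continuousOn.mono hKD).integrableOn_compact (μ := volume) hK
  refine ⟨(integrableOn_congr_fun hpt hK.measurableSet).2 (hi1.sub hi2), ?_⟩
  rw [setIntegral_congr_fun hK.measurableSet hpt, integral_sub hi1 hi2,
    setIntegral_divergence_eq_zero h.isOpen hK hKD (hz.of_le (natCast_le_infty 1))
      fun x hx => by rw [h0 x hx, smul_zero],
    firstVariation_eq_zero h hmin hK hKD hYX fun x hx => by rw [h0 x hx, map_zero], sub_zero]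

theorem integral_secondVariation_nonneg (h : IsImmersionOn F D) (hmin : IsMinimalOn F D)
    (hK : IsCompact K) (hKD : K ⊆ D) {X : E n → E n} (hX : ContDiffOn ℝ ∞ X D)
    (hX0 : ∀ x ∈ D \ K, X x = 0) {U A : E n → Ambient n m} (hU : ContDiffOn ℝ ∞ U D)
    (hA : ContDiffOn ℝ ∞ A D) (hA0 : ∀ x ∈ D \ K, A x = 0)
    (hpos : ∀ x ∈ D,
      0 ≤ fderiv ℝ (fderiv ℝ areaDensity) (fderiv ℝ F x) (fderiv ℝ U x) (fderiv ℝ U x))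
    {V : E n → Ambient n m} (hV : ∀ x ∈ D, V x = U x + fderiv ℝ F x (X x)) {Q : E n → ℝ}
    (hQ : IntegrableOn Q K) (hQV : ∀ x ∈ K, Q x =
      fderiv ℝ (fderiv ℝ areaDensity) (fderiv ℝ F x) (fderiv ℝ V x) (fderiv ℝ V x) +
        fderiv ℝ areaDensity (fderiv ℝ F x) (fderiv ℝ A x)) :
    0 ≤ ∫ x in K, Q x := by
  have hFX : ContDiffOn ℝ ∞ (fun y => fderiv ℝ F y (X y)) D :=
    (contDiffOn_fderiv h.smooth h.isOpen).clm_apply hX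
  -- With `T = dF·X`, polarization gives `D²a(dV, dV) = D²a(dU, dU) + D²a(d(2U + T), dT)`; hence the
  -- choice `Y = 2U + T`. The last term and the acceleration term integrate to zero and together
  -- bound `Q` from below.
  have hY : ContDiffOn ℝ ∞ (fun y => (2 : ℝ) • U y + fderiv ℝ F y (X y)) D :=
    (hU.const_smul 2).add hFX
  obtain ⟨hi, hzero⟩ := secondVariation_tangential_eq_zero h hmin hK hKD hX hX0 hY
  have hA' := firstVariation_eq_zero h hmin hK hKD hA hA0
  have hiA := ((h.contDiffOn_fderiv_density.clm_apply
    (contDiffOn_fderiv hA h.isOpen)).continuousOn.mono hKD).integrableOn_compact (μ := volume) hK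
  have hsum := integral_add hi hiA
  rw [hzero, hA', add_zero] at hsum
  rw [← hsum]
  refine setIntegral_mono_on (hi.add hiA) hQ hK.measurableSet fun x hx => ?_
  have hxD := hKD hx
  have hdU := (hU.contDiffAt (h.isOpen.mem_nhds hxD)).differentiableAt (by simp)
  have hdFX := (hFX.contDiffAt (h.isOpen.mem_nhds hxD)).differentiableAt (by simp)
  have eV : fderiv ℝ V x = fderiv ℝ U x + fderiv ℝ (fun y => fderiv ℝ F y (X y)) x := by
    have hev : V =ᶠ[𝓝 x] fun y => U y + fderiv ℝ F y (X y) := by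
      filter_upwards [h.isOpen.mem_nhds hxD] with y hy using hV y hy
    rw [hev.fderiv_eq, fderiv_fun_add hdU hdFX]
  have eY : fderiv ℝ (fun y => (2 : ℝ) • U y + fderiv ℝ F y (X y)) x =
      (2 : ℝ) • fderiv ℝ U x + fderiv ℝ (fun y => fderiv ℝ F y (X y)) x := by
    have hd2 : DifferentiableAt ℝ (fun y => (2 : ℝ) • U y) x := hdU.fun_const_smul 2
    rw [fderiv_fun_add hd2 hdFX, fderiv_fun_const_smul hdU]
  have hsymm := sndFDeriv_areaDensity_symm (h.det_pos x hxD) (fderiv ℝ U x)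
    (fderiv ℝ (fun y => fderiv ℝ F y (X y)) x)
  have hp := hpos x hxD
  simp only [hQV x hx, eV, eY, map_add, map_smul, _root_.add_apply, _root_.smul_apply, smul_eq_mul]
  linarith

/-! ### Stability of minimal graphs -/

section Graph

variable {n m : ℕ} {D : Set (E n)} {f : E n → E m}

theorem contDiffOn_graphMap (hf : ContDiffOn ℝ ∞ f D) : ContDiffOn ℝ ∞ (graphMap f) D := by
  refine contDiffOn_euclidean.2 fun k => ?_
  cases k with
  | inl i => exact (EuclideanSpace.proj i : E n →L[ℝ] ℝ).contDiff.contDiffOn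
  | inr a => exact contDiffOn_euclidean.1 hf a

theorem fderiv_graphMap_inl (hD : IsOpen D) (hf : ContDiffOn ℝ ∞ f D) {x : E n} (hx : x ∈ D)
    (v : E n) (i : Fin n) : fderiv ℝ (graphMap f) x v (Sum.inl i) = v i := by
  rw [fderiv_euclidean_apply (((contDiffOn_graphMap hf).contDiffAt
    (hD.mem_nhds hx)).differentiableAt (by simp))]
  exact congrArg (fun T => T v) (EuclideanSpace.proj i : E n →L[ℝ] ℝ).fderiv

theorem fderiv_graphMap_inr (hD : IsOpen D) (hf : ContDiffOn ℝ ∞ f D) {x : E n} (hx : x ∈ D)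
    (v : E n) (a : Fin m) : fderiv ℝ (graphMap f) x v (Sum.inr a) = fderiv ℝ f x v a := by
  rw [fderiv_euclidean_apply (((contDiffOn_graphMap hf).contDiffAt
    (hD.mem_nhds hx)).differentiableAt (by simp)),
    fderiv_euclidean_apply ((hf.contDiffAt (hD.mem_nhds hx)).differentiableAt (by simp))]
  rfl

theorem mixedGram_graphMap (hD : IsOpen D) (hf : ContDiffOn ℝ ∞ f D) {x : E n} (hx : x ∈ D) :
    mixedGram (fderiv ℝ (graphMap f) x) (fderiv ℝ (graphMap f) x) =
      1 + (jacobian f x).transpose * jacobian f x := by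
  ext i j
  simp only [mixedGram, Matrix.of_apply, PiLp.inner_apply, Fintype.sum_sum_type,
    fderiv_graphMap_inl hD hf hx, fderiv_graphMap_inr hD hf hx, Matrix.add_apply,
    Matrix.mul_apply, Matrix.transpose_apply, jacobian, partialD]
  congr 1
  · simp [Matrix.one_apply, eq_comm]
  · simp [mul_comm]

/-- The matrix of the target components of a linear map. -/
noncomputable def verticalMatrix (N : E n →L[ℝ] Ambient n m) : Matrix (Fin m) (Fin n) ℝ :=
  Matrix.of fun a i => N (EuclideanSpace.single i 1) (Sum.inr a)

theorem mixedGram_graphMap_vertical (hD : IsOpen D) (hf : ContDiffOn ℝ ∞ f D) {x : E n}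
    (hx : x ∈ D) {N : E n →L[ℝ] Ambient n m} (hN : ∀ v i, N v (Sum.inl i) = 0) :
    mixedGram (fderiv ℝ (graphMap f) x) N = (jacobian f x).transpose * verticalMatrix N := by
  ext i j
  simp only [mixedGram, Matrix.of_apply, PiLp.inner_apply, Fintype.sum_sum_type, hN,
    fderiv_graphMap_inr hD hf hx, Matrix.mul_apply, Matrix.transpose_apply, jacobian, partialD,
    verticalMatrix]
  simp [mul_comm]

theorem mixedGram_vertical {N : E n →L[ℝ] Ambient n m} (hN : ∀ v i, N v (Sum.inl i) = 0) :
    mixedGram N N = (verticalMatrix N).transpose * verticalMatrix N := by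
  ext i j
  simp only [mixedGram, Matrix.of_apply, PiLp.inner_apply, Fintype.sum_sum_type, hN,
    Matrix.mul_apply, Matrix.transpose_apply, verticalMatrix]
  simp [mul_comm]

theorem isImmersionOn_graphMap (hD : IsOpen D) (hf : ContDiffOn ℝ ∞ f D) :
    IsImmersionOn (graphMap f) D where
  isOpen := hD
  smooth := contDiffOn_graphMap hf
  det_pos x hx := by
    rw [mixedGram_graphMap hD hf hx]
    exact (posDef_one_add_transpose_mul _).det_pos

theorem sndFDeriv_areaDensity_vertical_nonneg (hD : IsOpen D) (hf : ContDiffOn ℝ ∞ f D) {x : E n}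
    (hx : x ∈ D) (hω : 1 / 2 ≤ starOmega f x) {N : E n →L[ℝ] Ambient n m}
    (hN : ∀ v i, N v (Sum.inl i) = 0) :
    0 ≤ fderiv ℝ (fderiv ℝ areaDensity) (fderiv ℝ (graphMap f) x) N N := by
  have hdet : (1 + (jacobian f x).transpose * jacobian f x).det ≤ 4 := by
    have hpos := (posDef_one_add_transpose_mul (jacobian f x)).det_pos
    have hs := Real.sqrt_pos.2 hpos
    rw [starOmega, div_le_div_iff₀ two_pos hs] at hω
    nlinarith [Real.sq_sqrt hpos.le]
  rw [sndFDeriv_areaDensity_self ((isImmersionOn_graphMap hD hf).det_pos x hx),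
    mixedGram_graphMap hD hf hx, mixedGram_graphMap_vertical hD hf hx hN, mixedGram_vertical hN]
  exact mul_nonneg (Real.sqrt_nonneg _) (densityHessian_nonneg _ _ hdet)

end Graph

/-! ### Time derivatives of the area density of a family -/

section TimeFamilies

variable {n : ℕ} {W : Type*} [NormedAddCommGroup W] [InnerProductSpace ℝ W]

theorem timeD_eq_zero_of_const {Φ : ℝ × E n → W} {J : Set ℝ} (hJ : IsOpen J) {x : E n} {w : W}
    (hd : ∀ s ∈ J, DifferentiableAt ℝ Φ (s, x)) (h : ∀ s ∈ J, Φ (s, x) = w) {s : ℝ} (hs : s ∈ J) :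
    timeD Φ (s, x) = 0 := by
  refine (hasDerivAt_timeD (hd s hs)).unique ((hasDerivAt_const s w).congr_of_eventuallyEq ?_)
  filter_upwards [hJ.mem_nhds hs] with t ht using h t ht

theorem contDiffOn_areaDensity_spaceD {Φ : ℝ × E n → W} {O : Set (ℝ × E n)} (hO : IsOpen O)
    (hΦ : ContDiffOn ℝ ∞ Φ O) (hdet : ∀ p ∈ O, 0 < (mixedGram (spaceD Φ p) (spaceD Φ p)).det) :
    ContDiffOn ℝ ∞ (fun p => areaDensity (spaceD Φ p)) O := fun p hp =>
  (contDiffAt_areaDensity (hdet p hp)).comp_contDiffWithinAt p (contDiffOn_spaceD hΦ hO p hp)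

theorem timeD_areaDensity_spaceD {Φ : ℝ × E n → W} {O : Set (ℝ × E n)} (hO : IsOpen O)
    (hΦ : ContDiffOn ℝ ∞ Φ O) (hdet : ∀ p ∈ O, 0 < (mixedGram (spaceD Φ p) (spaceD Φ p)).det)
    {s : ℝ} {x : E n} (hp : (s, x) ∈ O) :
    timeD (fun p => areaDensity (spaceD Φ p)) (s, x) =
      fderiv ℝ areaDensity (spaceD Φ (s, x)) (spaceD (timeD Φ) (s, x)) := by
  have hq := contDiffOn_areaDensity_spaceD hO hΦ hdet
  refine (hasDerivAt_timeD ((hq.contDiffAt (hO.mem_nhds hp)).differentiableAt (by simp))).unique ?_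
  have hd := ((contDiffAt_areaDensity (hdet _ hp)).differentiableAt (by simp)).hasFDerivAt
  exact hd.comp_hasDerivAt s (hasDerivAt_spaceD hΦ hO hp)

theorem timeD_timeD_areaDensity_spaceD {Φ : ℝ × E n → W} {O : Set (ℝ × E n)} (hO : IsOpen O)
    (hΦ : ContDiffOn ℝ ∞ Φ O) (hdet : ∀ p ∈ O, 0 < (mixedGram (spaceD Φ p) (spaceD Φ p)).det)
    {s : ℝ} {x : E n} (hp : (s, x) ∈ O) :
    timeD (timeD fun p => areaDensity (spaceD Φ p)) (s, x) =
      fderiv ℝ (fderiv ℝ areaDensity) (spaceD Φ (s, x)) (spaceD (timeD Φ) (s, x))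
          (spaceD (timeD Φ) (s, x)) +
        fderiv ℝ areaDensity (spaceD Φ (s, x)) (spaceD (timeD (timeD Φ)) (s, x)) := by
  have hq := contDiffOn_timeD (contDiffOn_areaDensity_spaceD hO hΦ hdet) hO
  have h1 := hasDerivAt_timeD ((hq.contDiffAt (hO.mem_nhds hp)).differentiableAt (by simp))
  have hd := (differentiableAt_fderiv_areaDensity (hdet _ hp)).hasFDerivAt
  have hc : HasDerivAt (fun t => fderiv ℝ areaDensity (spaceD Φ (t, x)))
      (fderiv ℝ (fderiv ℝ areaDensity) (spaceD Φ (s, x)) (spaceD (timeD Φ) (s, x))) s :=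
    HasFDerivAt.comp_hasDerivAt (l := fderiv ℝ areaDensity) (f := fun t => spaceD Φ (t, x))
      s hd (hasDerivAt_spaceD hΦ hO hp)
  have h2 := hc.clm_apply (hasDerivAt_spaceD (contDiffOn_timeD hΦ hO) hO hp)
  refine h1.unique (h2.congr_of_eventuallyEq ?_)
  have hnear : ∀ᶠ t in 𝓝 s, (t, x) ∈ O :=
    (by fun_prop : Continuous fun t : ℝ => (t, x)).continuousAt.eventually (hO.mem_nhds hp)
  filter_upwards [hnear] with t ht using timeD_areaDensity_spaceD hO hΦ hdet ht

end TimeFamilies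

theorem isStableOn_graphMap {n m : ℕ} {D : Set (E n)} (hD : IsOpen D) {f : E n → E m}
    (hf : ContDiffOn ℝ ∞ f D) (hmin : IsMinimalOn (graphMap f) D)
    (hω : ∀ x ∈ D, 1 / 2 ≤ starOmega f x) : IsStableOn (graphMap f) D := by
  intro K hK hKD ε F hε hF
  have himm := isImmersionOn_graphMap hD hf
  set Φ : ℝ × E n → Ambient n m := fun p => F p.1 p.2 with hΦdef
  set P : Set (ℝ × E n) := Ioo (-ε) ε ×ˢ D with hPdef
  have hP : IsOpen P := isOpen_Ioo.prod hD
  have hΦP : ContDiffOn ℝ ∞ Φ P := hF.smooth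
  have h0ε : (0 : ℝ) ∈ Ioo (-ε) ε := ⟨by linarith, hε⟩
  have hP0 : ∀ x ∈ D, ((0 : ℝ), x) ∈ P := fun x hx => ⟨h0ε, hx⟩
  have hdiff : ∀ {g : ℝ × E n → Ambient n m}, ContDiffOn ℝ ∞ g P → ∀ p ∈ P,
      DifferentiableAt ℝ g p := fun hg p hp =>
    (hg.contDiffAt (hP.mem_nhds hp)).differentiableAt (by simp)
  have htΦ := contDiffOn_timeD hΦP hP
  have httΦ := contDiffOn_timeD htΦ hP
  have hslice : ∀ {g : ℝ × E n → Ambient n m}, ContDiffOn ℝ ∞ g P →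
      ContDiffOn ℝ ∞ (fun x => g (0, x)) D := fun hg =>
    hg.comp (contDiff_prodMk_right (0 : ℝ)).contDiffOn fun x hx => hP0 x hx
  have hspace0 : ∀ x ∈ D, spaceD Φ (0, x) = fderiv ℝ (graphMap f) x := by
    intro x hx
    rw [← (hasFDerivAt_spaceD (hdiff hΦP _ (hP0 x hx))).fderiv]
    refine Filter.EventuallyEq.fderiv_eq ?_
    filter_upwards [hD.mem_nhds hx] with y hy using hF.initial y hy
  -- The open set of parameters where the family is still immersive, so that the density is smooth
  -- there; it contains `{0} × K`.
  set O : Set (ℝ × E n) := P ∩ spaceD Φ ⁻¹' {M | 0 < (mixedGram M M).det} with hOdef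
  have hO : IsOpen O := (contDiffOn_spaceD hΦP hP).continuousOn.isOpen_inter_preimage hP
    (isOpen_lt continuous_const continuous_det_mixedGram)
  have hOP : O ⊆ P := inter_subset_left
  have hdet : ∀ p ∈ O, 0 < (mixedGram (spaceD Φ p) (spaceD Φ p)).det := fun p hp => hp.2
  have hΦO : ContDiffOn ℝ ∞ Φ O := hΦP.mono hOP
  have hO0 : ∀ x ∈ K, ((0 : ℝ), x) ∈ O := fun x hx => by
    refine ⟨hP0 x (hKD hx), ?_⟩
    rw [mem_preimage, hspace0 x (hKD hx)]
    exact himm.det_pos x (hKD hx)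
  have hq := contDiffOn_areaDensity_spaceD hO hΦO hdet
  have hI : (fun t => volumeOver K (F t)) =ᶠ[𝓝 0]
      fun t => ∫ x in K, areaDensity (spaceD Φ (t, x)) := by
    filter_upwards [isOpen_Ioo.mem_nhds h0ε] with t ht
    refine setIntegral_congr_fun hK.measurableSet fun x hx => ?_
    have := (hasFDerivAt_spaceD (hdiff hΦP (t, x) ⟨ht, hKD hx⟩)).fderiv
    rw [← this]
    rfl
  obtain ⟨h1, h2⟩ := second_deriv_setIntegral hO hq hK hI hO0
  refine ⟨h1, h2.differentiableAt, ?_⟩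
  rw [h2.deriv]
  have hV0 : ∀ s ∈ Ioo (-ε) ε, ∀ x ∈ D \ K, timeD Φ (s, x) = 0 := fun s hs x hx =>
    timeD_eq_zero_of_const isOpen_Ioo (fun t ht => hdiff hΦP (t, x) ⟨ht, hx.1⟩)
      (fun t ht => hF.support t ht x hx) hs
  have hA0 : ∀ x ∈ D \ K, timeD (timeD Φ) (0, x) = 0 := fun x hx =>
    timeD_eq_zero_of_const isOpen_Ioo (fun t ht => hdiff htΦ (t, x) ⟨ht, hx.1⟩)
      (fun t ht => hV0 t ht x hx) h0ε
  set V : E n → Ambient n m := fun x => timeD Φ (0, x)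
  have hV : ContDiffOn ℝ ∞ V D := hslice htΦ
  -- The horizontal part of `V`. On a graph `dF·X` has horizontal part `X`, so the remainder `U` is
  -- vertical.
  set X : E n → E n := fun x => WithLp.toLp 2 fun i => V x (Sum.inl i) with hXdef
  have hX : ContDiffOn ℝ ∞ X D :=
    contDiffOn_euclidean.2 fun i => contDiffOn_euclidean.1 hV (Sum.inl i)
  set U : E n → Ambient n m := fun x => V x - fderiv ℝ (graphMap f) x (X x) with hUdef
  have hU : ContDiffOn ℝ ∞ U D :=
    hV.sub ((contDiffOn_fderiv himm.smooth hD).clm_apply hX)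
  have hUvert : ∀ x ∈ D, ∀ v i, fderiv ℝ U x v (Sum.inl i) = 0 := by
    intro x hx v i
    rw [fderiv_euclidean_apply ((hU.contDiffAt (hD.mem_nhds hx)).differentiableAt (by simp))]
    have hev : (fun y => U y (Sum.inl i)) =ᶠ[𝓝 x] fun _ => 0 := by
      filter_upwards [hD.mem_nhds hx] with y hy
      simp [hUdef, fderiv_graphMap_inl hD hf hy, hXdef]
    rw [hev.fderiv_eq]
    simp
  refine integral_secondVariation_nonneg himm hmin hK hKD hX
    (fun x hx => ?_) hU (hslice httΦ) hA0
    (fun x hx => sndFDeriv_areaDensity_vertical_nonneg hD hf hx (hω x hx) (hUvert x hx))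
    (V := V) (fun x hx => (sub_add_cancel _ _).symm) ?_ fun x hx => ?_
  · ext i
    simp [hXdef, V, hV0 0 h0ε x hx]
  · have hc := (contDiffOn_timeD (contDiffOn_timeD hq hO) hO).continuousOn
    exact (hc.comp (by fun_prop) hO0).integrableOn_compact hK
  · rw [timeD_timeD_areaDensity_spaceD hO hΦO hdet (hO0 x hx), hspace0 x (hKD hx),
      (hasFDerivAt_spaceD (hdiff htΦ _ (hP0 x (hKD hx)))).fderiv,
      (hasFDerivAt_spaceD (hdiff httΦ _ (hP0 x (hKD hx)))).fderiv]

/-! ### Comparison of the threshold with 1/2 -/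

theorem one_le_stabilityConst (n m : ℕ) : 1 ≤ stabilityConst n m := by
  rw [stabilityConst]
  split_ifs with h
  · exact le_rfl
  · push Not at h
    have h1 : (3 : ℝ) ≤ m := by exact_mod_cast h.1
    have h2 : (3 : ℝ) ≤ n := by exact_mod_cast h.2
    exact le_min (by linarith) (by linarith)

/-- Since `√(1 + c) ≥ 1`, the denominator is at most `2c`. -/
theorem half_le_threshold {c : ℝ} (hc : 1 ≤ c) :
    1 / 2 ≤ c / (2 * (c + 1 - Real.sqrt (1 + c))) := by
  have hs : Real.sqrt (1 + c) ^ 2 = 1 + c := Real.sq_sqrt (by linarith)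
  have h1 : 1 < Real.sqrt (1 + c) := by
    rw [Real.lt_sqrt zero_le_one]
    linarith
  rw [div_le_div_iff₀ two_pos (by nlinarith)]
  linarith

end MinimalGraph

theorem mainTheorem2 (n m : ℕ)
    (D : Set (MinimalGraph.E n)) (hD : IsOpen D)
    (f : MinimalGraph.E n → MinimalGraph.E m)
    (hf : ContDiffOn ℝ ((⊤ : ℕ∞) : WithTop ℕ∞) f D)
    (hmin : MinimalGraph.IsMinimalOn (MinimalGraph.graphMap f) D) :
    ((∀ x ∈ D, MinimalGraph.stabilityConst n m /
          (2 * (MinimalGraph.stabilityConst n m + 1 -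
            Real.sqrt (1 + MinimalGraph.stabilityConst n m))) ≤ MinimalGraph.starOmega f x) →
        MinimalGraph.IsStableOn (MinimalGraph.graphMap f) D) ∧
      ((m ≤ 2 ∨ n ≤ 2) →
        (∀ x ∈ D, (2 + Real.sqrt 2) / 4 ≤ MinimalGraph.starOmega f x) →
        MinimalGraph.IsStableOn (MinimalGraph.graphMap f) D) := by
  refine ⟨fun h => ?_, fun _ h => ?_⟩
  · exact MinimalGraph.isStableOn_graphMap hD hf hmin fun x hx =>
      (MinimalGraph.half_le_threshold (MinimalGraph.one_le_stabilityConst n m)).trans (h x hx)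
  · refine MinimalGraph.isStableOn_graphMap hD hf hmin fun x hx => le_trans ?_ (h x hx)
    linarith [Real.sqrt_nonneg 2]
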